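/- Let $\Sigma$ be a finite alphabet having at least two letters, and let $T_\Sigma^\omega$ be the set of infinite binary $\Sigma$-labelled trees, i.e. of functions $t:\{l,r\}^\star\to\Sigma$. A path of a tree $t$ is the infinite word of labels read along an infinite branch from the root. A (nondeterministic) tree automaton over $\Sigma$ consists of a finite set $Q$ of states, an initial state $q_0\in Q$ and a transition relation $\Delta\subseteq Q\times\Sigma\times Q\times Q$. A run of it on $t\in T_\Sigma^\omega$ is a tree $\rho\in T_Q^\omega$ such that $\rho(\lambda)=q_0$, where $\lambda$ is the empty word, and $(\rho(u),t(u),\rho(ul),\rho(ur))\in\Delta$ for each $u\in\{l,r\}^\star$. A Büchi tree automaton has in addition a set $Q_f\subseteq Q$, and accepts $t$ if there is a run on $t$ such that on each path of the run some state of $Q_f$ appears infinitely often. A Muller tree automaton has instead a collection $\mathcal F\subseteq 2^Q$, and accepts $t$ if there is a run on $t$ such that, for each path of the run, the set of states appearing infinitely often on this path is in $\mathcal F$. The Büchi topology (resp. the Muller topology) on $T_\Sigma^\omega$ is the topology generated by the tree languages accepted by Büchi (resp. Muller) tree automata. A topological space $X$ is called regular if for every point $x$ and every open neighbourhood $U$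 of $x$ there is an open neighbourhood $V$ of $x$ with $\overline V\subseteq U$; zero-dimensional if it has a basis made of clopen sets; and strong Choquet if it is nonempty and Player 2 has a winning strategy in the following game. At turn $i$, Player 1 plays an open set $U_i$ and a point $x_i\in U_i$, with $U_i\subseteq V_{i-1}$ if $i\ge 1$; then Player 2 plays an open set $V_i$ with $x_i\in V_i\subseteq U_i$. Player 2 wins if $\bigcap_{i\in\mathbb N}V_i\neq\emptyset$. A space is Polish if it is separable and completely metrizable. **Theorem.** 1. The Büchi topology on $T_\Sigma^\omega$ is strong Choquet, but it is not regular (and hence not zero-dimensional) and not metrizable. 2. The Muller topology on $T_\Sigma^\omega$ is zero-dimensional, regular and metrizable, but it is not strong Choquet. In particular, the Büchi topology and the Muller topology on $T_\Sigma^\omega$ are not Polish. -/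

import Mathlib

namespace TreeTopology

open Set Filter

/-- Nodes of the infinite binary tree: finite words over the two directions
`false` (left) and `true` (right). The empty word is the root and the two children
of a node `u` are `u ++ [false]` and `u ++ [true]`. -/
abbrev Node : Type := List Bool

/-- The space of infinite binary trees with nodes labelled by letters of `A`. -/
abbrev InfTree (A : Type*) : Type _ := Node → A

/-- The node of length `n` on the infinite branch with directions `d 0, d 1, d 2, …`. -/
def branchNode (d : ℕ → Bool) (n : ℕ) : Node := List.ofFn (fun i : Fin n => d i)

/-- The path of the tree `t` along the maximal branch given by `d`: the infinite word
of the labels of `t` at the successive nodes of that branch, from the root on. -/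
def path {A : Type*} (t : InfTree A) (d : ℕ → Bool) : ℕ → A := fun n => t (branchNode d n)

/-- The set of letters that appear infinitely often in an infinite word. -/
def infOften {A : Type*} (p : ℕ → A) : Set A := {a | ∃ᶠ n in atTop, p n = a}

/-- A (nondeterministic) tree automaton with input alphabet `A` and state set `Q`. -/
structure TreeAutomaton (A : Type*) (Q : Type*) where
  /-- the initial state -/
  init : Q
  /-- the transition relation, a subset of `Q × A × Q × Q` -/
  trans : Set (Q × A × Q × Q)

/-- `ρ` is a run of the automaton `M` on the tree `t`. -/
def TreeAutomaton.IsRun {A Q : Type*} (M : TreeAutomaton A Q) (t : InfTree A)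
    (ρ : InfTree Q) : Prop :=
  ρ [] = M.init ∧ ∀ u : Node, (ρ u, t u, ρ (u ++ [false]), ρ (u ++ [true])) ∈ M.trans

/-- The tree language accepted by `M` with the Büchi condition `F`: trees with a run
on every path of which some state of `F` appears infinitely often. -/
def TreeAutomaton.buchiLanguage {A Q : Type*} (M : TreeAutomaton A Q) (F : Set Q) :
    Set (InfTree A) :=
  {t | ∃ ρ : InfTree Q, M.IsRun t ρ ∧ ∀ d : ℕ → Bool, ∃ q ∈ F, q ∈ infOften (path ρ d)}

/-- The tree language accepted by `M` with the Muller condition `𝓕`: trees with a run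
on every path of which the set of states that appear infinitely often belongs to `𝓕`. -/
def TreeAutomaton.mullerLanguage {A Q : Type*} (M : TreeAutomaton A Q) (𝓕 : Set (Set Q)) :
    Set (InfTree A) :=
  {t | ∃ ρ : InfTree Q, M.IsRun t ρ ∧ ∀ d : ℕ → Bool, infOften (path ρ d) ∈ 𝓕}

/-- `L` is accepted by some Büchi tree automaton with finitely many states. -/
def IsBuchiRecognizable {A : Type*} (L : Set (InfTree A)) : Prop :=
  ∃ (Q : Type) (_ : Finite Q) (M : TreeAutomaton A Q) (F : Set Q), L = M.buchiLanguage F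

/-- `L` is accepted by some Muller tree automaton with finitely many states. -/
def IsMullerRecognizable {A : Type*} (L : Set (InfTree A)) : Prop :=
  ∃ (Q : Type) (_ : Finite Q) (M : TreeAutomaton A Q) (𝓕 : Set (Set Q)),
    L = M.mullerLanguage 𝓕

/-- The Büchi topology: generated by the tree languages accepted by Büchi tree automata. -/
abbrev buchiTopology (A : Type*) : TopologicalSpace (InfTree A) :=
  TopologicalSpace.generateFrom {L | IsBuchiRecognizable L}

/-- The Muller topology: generated by the tree languages accepted by Muller tree automata. -/
abbrev mullerTopology (A : Type*) : TopologicalSpace (InfTree A) :=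
  TopologicalSpace.generateFrom {L | IsMullerRecognizable L}

/-- A topological space is zero-dimensional if it has a basis made of clopen sets. -/
def IsZeroDimensional (X : Type*) [TopologicalSpace X] : Prop :=
  ∃ B : Set (Set X), TopologicalSpace.IsTopologicalBasis B ∧ ∀ s ∈ B, IsClopen s

/-- A strategy of Player 2 in the strong Choquet game on `X`: it maps the nonempty list
`(U₀, x₀), …, (Uₙ, xₙ)` of the moves made by Player 1 so far to the answer `Vₙ`. -/
abbrev ChoquetStrategy (X : Type*) : Type _ := List (Set X × X) → Set X

/-- The answer `Vₙ` of Player 2, following `σ`, when Player 1 plays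
`(U 0, x 0), (U 1, x 1), …`. -/
def ChoquetStrategy.answer {X : Type*} (σ : ChoquetStrategy X) (U : ℕ → Set X) (x : ℕ → X)
    (n : ℕ) : Set X :=
  σ (List.ofFn (fun i : Fin (n + 1) => (U i, x i)))

/-- The `n`-th move `(U n, x n)` of Player 1 against `σ` obeys the rules: `U n` is open,
contains `x n`, and is contained in the previous answer of Player 2 (if there is one). -/
def ChoquetStrategy.LegalMove {X : Type*} [TopologicalSpace X] (σ : ChoquetStrategy X)
    (U : ℕ → Set X) (x : ℕ → X) (n : ℕ) : Prop :=
  IsOpen (U n) ∧ x n ∈ U n ∧ ∀ m, n = m + 1 → U n ⊆ σ.answer U x m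

/-- `σ` is a winning strategy of Player 2: as long as Player 1 obeys the rules, the answers
of `σ` obey them too, and if Player 1 obeys them forever, then the intersection of all
the sets played by Player 2 is nonempty. -/
def ChoquetStrategy.IsWinning {X : Type*} [TopologicalSpace X] (σ : ChoquetStrategy X) : Prop :=
  ∀ (U : ℕ → Set X) (x : ℕ → X),
    (∀ n, (∀ i ≤ n, σ.LegalMove U x i) →
      IsOpen (σ.answer U x n) ∧ x n ∈ σ.answer U x n ∧ σ.answer U x n ⊆ U n) ∧
    ((∀ n, σ.LegalMove U x n) → (⋂ n, σ.answer U x n).Nonempty)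

/-- A topological space is strong Choquet if it is nonempty and Player 2 has a winning
strategy in the strong Choquet game. -/
def IsStrongChoquet (X : Type*) [TopologicalSpace X] : Prop :=
  Nonempty X ∧ ∃ σ : ChoquetStrategy X, σ.IsWinning

end TreeTopology

/-! Let `L` be the set of the trees having a branch on which the letter `a` occurs infinitely often.
It is a Büchi language, hence open in both topologies, and both topologies are second countable and
refine the product topology. A diagonal argument (`not_analyticSet_no_branch`) shows that the
complement of `L` is not analytic in the product topology. So neither topology is a continuous image
of the Baire space: the closed set `Lᶜ` would pull back to a closed set, whose image is analytic
(`not_exists_continuous_surjective`). Nonempty Polish spaces are such images, and so are second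
countable metrizable strong Choquet spaces. By Urysohn's metrization theorem, a second countable
topology that refines the Büchi topology therefore cannot be both regular and strong Choquet.

It remains to see which of the two properties each topology has. In the Büchi topology Player 2 wins
by fixing longer and longer finite parts of a tree and of accepting runs on it, such that every
branch meets an accepting state between successive depths; the limits of these runs are accepting
(`isStrongChoquet_buchi`).

The Muller topology has a clopen basis because Muller languages are closed under complement
(`IsMullerRecognizable.compl`, Rabin's theorem). With visit records the acceptance game becomes a
parity game, in which the opponent of the automaton has a positional strategy as soon as the
automaton loses (`positional_determinacy`). Such a strategy is a labelling of the tree by finitely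
many letters. That it defeats all runs is a condition on single branches, whose negation is
recognized by a nondeterministic word automaton. Determinizing that automaton
(`isDetMuller_mullerAccepts`, McNaughton's theorem) lets a tree automaton guess and check the
labelling. -/

namespace TreeTopology

open Set Filter Topology

/-! ### Letters occurring infinitely often in a word. -/

section Words

theorem mem_infOften {A : Type*} {p : ℕ → A} {a : A} :
    a ∈ infOften p ↔ ∃ᶠ n in atTop, p n = a := Iff.rfl

theorem exists_mem_infOften {Q : Type*} [Finite Q] {p : ℕ → Q} {S : Set Q}
    (h : ∃ᶠ n in atTop, p n ∈ S) : ∃ q ∈ S, q ∈ infOften p := by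
  by_contra! hc
  refine h ?_
  have : ∀ q : Q, ∀ᶠ n in atTop, q ∈ S → p n ≠ q := by
    intro q
    by_cases hq : q ∈ S
    · have := hc q hq
      rw [mem_infOften, not_frequently] at this
      exact this.mono fun n hn _ => hn
    · exact Eventually.of_forall fun n h => absurd h hq
  filter_upwards [eventually_all.2 this] with n hn hS
  exact hn _ hS rfl

theorem eventually_mem_infOften {Q : Type*} [Finite Q] (p : ℕ → Q) :
    ∀ᶠ n in atTop, p n ∈ infOften p := by
  by_contra h
  obtain ⟨q, hq, hq'⟩ := exists_mem_infOften (S := (infOften p)ᶜ)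
    ((not_eventually.1 h).mono fun n hn => hn)
  exact hq hq'

theorem infOften_nonempty {Q : Type*} [Finite Q] (p : ℕ → Q) : (infOften p).Nonempty := by
  obtain ⟨q, -, hq⟩ := exists_mem_infOften (p := p) (S := univ)
    (Frequently.of_forall fun _ => mem_univ _)
  exact ⟨q, hq⟩

theorem frequently_mem_iff {Q : Type*} [Finite Q] {p : ℕ → Q} {S : Set Q} :
    (∃ᶠ n in atTop, p n ∈ S) ↔ (S ∩ infOften p).Nonempty := by
  refine ⟨fun h => ?_, fun ⟨q, hS, hq⟩ => hq.mono fun n hn => hn ▸ hS⟩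
  obtain ⟨q, hS, hq⟩ := exists_mem_infOften h
  exact ⟨q, hS, hq⟩

theorem eventually_mem_iff {Q : Type*} [Finite Q] {p : ℕ → Q} {S : Set Q} :
    (∀ᶠ n in atTop, p n ∈ S) ↔ infOften p ⊆ S := by
  refine ⟨fun h q hq => ?_, fun h => (eventually_mem_infOften p).mono fun n hn => h hn⟩
  obtain ⟨n, hn, rfl⟩ := (h.and_frequently hq).exists
  exact hn

theorem infOften_comp {Q R : Type*} [Finite Q] (f : Q → R) (p : ℕ → Q) :
    infOften (f ∘ p) = f '' infOften p := by
  ext r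
  have : r ∈ infOften (f ∘ p) ↔ ∃ᶠ n in atTop, p n ∈ f ⁻¹' {r} := Iff.rfl
  rw [this, frequently_mem_iff]
  constructor
  · rintro ⟨q, hq, hq'⟩
    exact ⟨q, hq', hq⟩
  · rintro ⟨q, hq, rfl⟩
    exact ⟨q, rfl, hq⟩

theorem infOften_shift {Q : Type*} (p : ℕ → Q) (k : ℕ) :
    infOften (fun n => p (n + k)) = infOften p := by
  ext q
  simp only [mem_infOften, frequently_atTop]
  constructor
  · intro h N
    obtain ⟨n, hn, h⟩ := h N
    exact ⟨n + k, by omega, h⟩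
  · intro h N
    obtain ⟨n, hn, h⟩ := h (N + k)
    exact ⟨n - k, by omega, by rwa [Nat.sub_add_cancel (by omega)]⟩

end Words

/-! ### Branches of the binary tree. -/

section Branches

@[simp] theorem branchNode_zero (d : ℕ → Bool) : branchNode d 0 = [] := by
  simp [branchNode]

theorem branchNode_succ (d : ℕ → Bool) (n : ℕ) :
    branchNode d (n + 1) = branchNode d n ++ [d n] := by
  rw [branchNode, List.ofFn_succ', List.concat_eq_append]
  rfl

@[simp] theorem length_branchNode (d : ℕ → Bool) (n : ℕ) : (branchNode d n).length = n := by
  simp [branchNode]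

theorem branchNode_injective {d e : ℕ → Bool} {n : ℕ} (h : branchNode d n = branchNode e n) :
    ∀ i < n, d i = e i := by
  intro i hi
  have := congrFun (List.ofFn_injective h) ⟨i, hi⟩
  exact this

/-- Used to extract the branch that a run or a strategy determines one direction at a time. -/
theorem exists_branch (κ : Node → Bool) : ∃ d : ℕ → Bool, ∀ n, d n = κ (branchNode d n) := by
  let N : ℕ → Node := fun n => Nat.rec [] (fun _ u => u ++ [κ u]) n
  have hN : ∀ n, branchNode (fun n => κ (N n)) n = N n := by
    intro n
    induction n with
    | zero => simp [N]
    | succ n ih => rw [branchNode_succ, ih]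
  exact ⟨fun n => κ (N n), fun n => by rw [hN]⟩

end Branches

/-! ### Renaming of states and countability of the recognizable languages. -/

section Recognizable

/-- Transport of a tree automaton along a bijection of state sets. -/
def TreeAutomaton.map {A Q R : Type*} (M : TreeAutomaton A Q) (e : Q ≃ R) : TreeAutomaton A R where
  init := e M.init
  trans := {x | (e.symm x.1, x.2.1, e.symm x.2.2.1, e.symm x.2.2.2) ∈ M.trans}

theorem TreeAutomaton.isRun_map {A Q R : Type*} (M : TreeAutomaton A Q) (e : Q ≃ R)
    (t : InfTree A) (ρ : InfTree Q) : (M.map e).IsRun t (fun u => e (ρ u)) ↔ M.IsRun t ρ := by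
  simp [TreeAutomaton.IsRun, TreeAutomaton.map]

theorem infOften_equiv {Q R : Type*} (e : Q ≃ R) (p : ℕ → Q) :
    infOften (fun n => e (p n)) = e '' infOften p := by
  ext r
  constructor
  · intro h
    exact ⟨e.symm r, h.mono fun n hn => by simp [← hn], by simp⟩
  · rintro ⟨q, hq, rfl⟩
    exact hq.mono fun n hn => by simp [hn]

theorem TreeAutomaton.mullerLanguage_map {A Q R : Type*} (M : TreeAutomaton A Q) (e : Q ≃ R)
    (𝓕 : Set (Set Q)) :
    (M.map e).mullerLanguage {X | e ⁻¹' X ∈ 𝓕} = M.mullerLanguage 𝓕 := by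
  have key : ∀ (ρ : InfTree Q) d, e ⁻¹' infOften (path (fun u => e (ρ u)) d) =
      infOften (path ρ d) := fun ρ d => by
    rw [show path (fun u => e (ρ u)) d = fun n => e (path ρ d n) from rfl, infOften_equiv,
      e.preimage_image]
  ext t
  constructor
  · rintro ⟨ρ, hρ, h⟩
    obtain ⟨ρ, rfl⟩ : ∃ ρ' : InfTree Q, ρ = fun u => e (ρ' u) :=
      ⟨fun u => e.symm (ρ u), by simp⟩
    refine ⟨ρ, (M.isRun_map e t ρ).1 hρ, fun d => ?_⟩
    rw [← key]
    exact h d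
  · rintro ⟨ρ, hρ, h⟩
    refine ⟨fun u => e (ρ u), (M.isRun_map e t ρ).2 hρ, fun d => ?_⟩
    rw [mem_ofPred_eq, key]
    exact h d

theorem TreeAutomaton.buchiLanguage_eq_mullerLanguage {A Q : Type*} (M : TreeAutomaton A Q)
    (F : Set Q) : M.buchiLanguage F = M.mullerLanguage {X | ∃ q ∈ F, q ∈ X} := rfl

theorem TreeAutomaton.buchiLanguage_map {A Q R : Type*} (M : TreeAutomaton A Q) (e : Q ≃ R)
    (F : Set Q) : (M.map e).buchiLanguage (e '' F) = M.buchiLanguage F := by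
  rw [buchiLanguage_eq_mullerLanguage, buchiLanguage_eq_mullerLanguage, ← M.mullerLanguage_map e]
  congr 1
  ext X
  simp only [mem_ofPred_eq, exists_mem_image, mem_preimage]

theorem TreeAutomaton.isMullerRecognizable {A Q : Type*} [Finite Q] (M : TreeAutomaton A Q)
    (𝓕 : Set (Set Q)) : IsMullerRecognizable (M.mullerLanguage 𝓕) := by
  obtain ⟨n, ⟨e⟩⟩ := Finite.exists_equiv_fin Q
  exact ⟨Fin n, inferInstance, M.map e, _, (M.mullerLanguage_map e 𝓕).symm⟩

theorem TreeAutomaton.isBuchiRecognizable {A Q : Type*} [Finite Q] (M : TreeAutomaton A Q)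
    (F : Set Q) : IsBuchiRecognizable (M.buchiLanguage F) := by
  obtain ⟨n, ⟨e⟩⟩ := Finite.exists_equiv_fin Q
  exact ⟨Fin n, inferInstance, M.map e, _, (M.buchiLanguage_map e F).symm⟩

theorem IsBuchiRecognizable.isMullerRecognizable {A : Type*} {L : Set (InfTree A)}
    (h : IsBuchiRecognizable L) : IsMullerRecognizable L := by
  obtain ⟨Q, _, M, F, rfl⟩ := h
  exact M.isMullerRecognizable {X | ∃ q ∈ F, q ∈ X}

/-- Büchi automata with a state set of the form `Fin n`. -/
abbrev FinBuchi (A : Type*) : Type _ := Σ n : ℕ, TreeAutomaton A (Fin n) × Set (Fin n)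

theorem IsBuchiRecognizable.exists_finBuchi {A : Type*} {L : Set (InfTree A)}
    (h : IsBuchiRecognizable L) : ∃ α : FinBuchi A, L = α.2.1.buchiLanguage α.2.2 := by
  obtain ⟨Q, _, M, F, rfl⟩ := h
  obtain ⟨n, ⟨e⟩⟩ := Finite.exists_equiv_fin Q
  exact ⟨⟨n, M.map e, _⟩, (M.buchiLanguage_map e F).symm⟩

instance {A Q : Type*} [Finite A] [Finite Q] : Finite (TreeAutomaton A Q) :=
  Finite.of_injective (β := Q × Set (Q × A × Q × Q)) (fun M => (M.init, M.trans))
    fun M N h => by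
      cases M; cases N
      simpa using h

theorem countable_isMullerRecognizable (A : Type*) [Finite A] :
    {L : Set (InfTree A) | IsMullerRecognizable L}.Countable := by
  refine (countable_range (fun α : Σ n : ℕ, TreeAutomaton A (Fin n) × Set (Set (Fin n)) =>
    α.2.1.mullerLanguage α.2.2)).mono ?_
  rintro _ ⟨Q, _, M, 𝓕, rfl⟩
  obtain ⟨n, ⟨e⟩⟩ := Finite.exists_equiv_fin Q
  exact ⟨⟨n, M.map e, _⟩, M.mullerLanguage_map e 𝓕⟩

theorem countable_isBuchiRecognizable (A : Type*) [Finite A] :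
    {L : Set (InfTree A) | IsBuchiRecognizable L}.Countable :=
  (countable_isMullerRecognizable A).mono fun _ h => h.isMullerRecognizable

theorem secondCountable_mullerTopology (A : Type*) [Finite A] :
    @SecondCountableTopology (InfTree A) (mullerTopology A) :=
  @SecondCountableTopology.mk _ (mullerTopology A) ⟨_, countable_isMullerRecognizable A, rfl⟩

theorem secondCountable_buchiTopology (A : Type*) [Finite A] :
    @SecondCountableTopology (InfTree A) (buchiTopology A) :=
  @SecondCountableTopology.mk _ (buchiTopology A) ⟨_, countable_isBuchiRecognizable A, rfl⟩

end Recognizable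

/-! ### Finite constraints on trees and runs; comparison with the product topology. -/

section Constrained

/-- A run of `M` all of whose paths visit `F` infinitely often. -/
def TreeAutomaton.IsAcceptingRun {A Q : Type*} (M : TreeAutomaton A Q) (F : Set Q) (t : InfTree A)
    (ρ : InfTree Q) : Prop :=
  M.IsRun t ρ ∧ ∀ d : ℕ → Bool, ∃ q ∈ F, q ∈ infOften (path ρ d)

/-- The automaton that simulates `M` and checks the constraint `K` at the nodes of
length less than `n`. -/
def TreeAutomaton.constrain {A Q : Type*} (M : TreeAutomaton A Q) (n : ℕ)
    (K : Node → Q → A → Prop) : TreeAutomaton A (Q × Option {u : Node // u.length ≤ n}) where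
  init := (M.init, some ⟨[], Nat.zero_le n⟩)
  trans := {x | (x.1.1, x.2.1, x.2.2.1.1, x.2.2.2.1) ∈ M.trans ∧
    ∀ u, x.1.2 = some u → u.1.length < n → K u.1 x.1.1 x.2.1 ∧
      ∀ h : u.1.length + 1 ≤ n, x.2.2.1.2 = some ⟨u.1 ++ [false], by simpa using h⟩ ∧
        x.2.2.2.2 = some ⟨u.1 ++ [true], by simpa using h⟩}

/-- A finite memory suffices to know the current node up to depth `n`, so finitely many prescribed
values of the run and the tree can be checked. This makes the sets played by Player 2 in the Büchi
topology open. -/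
theorem isBuchiRecognizable_constrained {A Q : Type*} [Finite Q] (M : TreeAutomaton A Q)
    (F : Set Q) (n : ℕ) (K : Node → Q → A → Prop) :
    IsBuchiRecognizable {t : InfTree A | ∃ ρ : InfTree Q, M.IsAcceptingRun F t ρ ∧
      ∀ u : Node, u.length < n → K u (ρ u) (t u)} := by
  classical
  have : Finite {u : Node // u.length ≤ n} := List.finite_length_le Bool n
  convert (M.constrain n K).isBuchiRecognizable (Prod.fst ⁻¹' F) using 1
  ext t
  constructor
  · rintro ⟨ρ, ⟨⟨h0, h1⟩, h2⟩, h3⟩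
    refine ⟨fun u => (ρ u, if h : u.length ≤ n then some ⟨u, h⟩ else none), ⟨?_, ?_⟩, ?_⟩
    · simp [TreeAutomaton.constrain, h0]
    · intro u
      refine ⟨h1 u, ?_⟩
      rintro ⟨v, hv⟩ hu hlt
      have : u = v := by
        by_contra hne
        by_cases h : u.length ≤ n <;> simp_all
      subst this
      refine ⟨h3 u hlt, fun h => ?_⟩
      simp [Nat.succ_le_of_lt hlt]
    · intro d
      obtain ⟨q, hq, hq'⟩ := h2 d
      obtain ⟨x, hx, hx'⟩ := exists_mem_infOften (S := Prod.fst ⁻¹' F)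
        (p := path (fun u => (ρ u, if h : u.length ≤ n then some
          (⟨u, h⟩ : {u : Node // u.length ≤ n}) else none)) d)
        (hq'.mono fun k hk => by
          change path ρ d k ∈ F
          rwa [hk])
      exact ⟨x, hx, hx'⟩
  · rintro ⟨ρ, ⟨h0, h1⟩, h2⟩
    have hnode : ∀ u : Node, ∀ h : u.length ≤ n, (ρ u).2 = some ⟨u, h⟩ := by
      intro u
      induction u using List.reverseRecOn with
      | nil => intro h; rw [h0]; rfl
      | append_singleton u b ih =>
        intro h
        have hl : u.length + 1 ≤ n := by simpa using h
        have := ((h1 u).2 ⟨u, by omega⟩ (ih (by omega)) (by simpa using hl)).2 hl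
        cases b
        · exact this.1
        · exact this.2
    refine ⟨fun u => (ρ u).1, ⟨⟨?_, fun u => (h1 u).1⟩, fun d => ?_⟩, fun u hu => ?_⟩
    · exact congrArg Prod.fst h0
    · obtain ⟨q, hq, hq'⟩ := h2 d
      exact ⟨q.1, hq, hq'.mono fun k hk => by
        change (path ρ d k).1 = q.1
        rw [hk]⟩
    · exact ((h1 u).2 ⟨u, hu.le⟩ (hnode u hu.le) hu).1

/-- The automaton with a single state, which accepts all trees. -/
def trivialAutomaton (A : Type*) : TreeAutomaton A Unit where
  init := ()
  trans := univ

theorem isBuchiRecognizable_prefix {A : Type*} (t₀ : InfTree A) (n : ℕ) :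
    IsBuchiRecognizable {t : InfTree A | ∀ u : Node, u.length < n → t u = t₀ u} := by
  convert isBuchiRecognizable_constrained (trivialAutomaton A) univ n (fun u _ a => a = t₀ u) using 1
  ext t
  constructor
  · intro h
    exact ⟨fun _ => (), ⟨⟨rfl, fun _ => mem_univ _⟩, fun d => ⟨(), mem_univ _,
      Frequently.of_forall fun _ => rfl⟩⟩, h⟩
  · rintro ⟨_, -, h⟩
    exact h

/-- The product topology on the space of trees, the alphabet being discrete. -/
abbrev cantorTopology (A : Type*) : TopologicalSpace (InfTree A) :=
  @Pi.topologicalSpace Node (fun _ => A) (fun _ => ⊥)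

theorem isBuchiRecognizable_label {A : Type*} (v : Node) (a : A) :
    IsBuchiRecognizable {t : InfTree A | t v = a} := by
  convert isBuchiRecognizable_constrained (trivialAutomaton A) univ (v.length + 1)
    (fun u _ b => u = v → b = a) using 1
  ext t
  constructor
  · intro h
    exact ⟨fun _ => (), ⟨⟨rfl, fun _ => mem_univ _⟩, fun d => ⟨(), mem_univ _,
      Frequently.of_forall fun _ => rfl⟩⟩, fun u _ hu => hu ▸ h⟩
  · rintro ⟨_, -, h⟩
    exact h v (Nat.lt_succ_self _) rfl

theorem buchiTopology_le_cantor (A : Type*) : buchiTopology A ≤ cantorTopology A := by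
  let : TopologicalSpace A := ⊥
  have : DiscreteTopology A := ⟨rfl⟩
  rw [← continuous_id_iff_le]
  refine @continuous_pi _ _ _ (buchiTopology A) _ _ fun v => ?_
  refine @Continuous.mk _ _ (buchiTopology A) _ _ fun s _ => ?_
  have : (fun t : InfTree A => id t v) ⁻¹' s = ⋃ a ∈ s, {t : InfTree A | t v = a} := by
    ext t; simp
  rw [this]
  exact @isOpen_biUnion _ _ (buchiTopology A) _ _ fun a _ =>
    TopologicalSpace.isOpen_generateFrom_of_mem (isBuchiRecognizable_label v a)

theorem mullerTopology_le_buchi (A : Type*) : mullerTopology A ≤ buchiTopology A :=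
  TopologicalSpace.generateFrom_anti fun _ h => h.isMullerRecognizable

end Constrained

/-! ### The Büchi language of the trees with a branch containing infinitely many `a`. -/

section InfinitelyOften

/-- The automaton that guesses a branch and checks that the letter `a` occurs infinitely often
on it: `none` is the state off the branch, and `some b` is the state on the branch, where `b`
tells whether the parent is labelled by `a`. -/
def branchAutomaton {A : Type*} (a : A) : TreeAutomaton A (Option Prop) where
  init := some False
  trans := {x | (x.1 = none ∧ x.2.2 = (none, none)) ∨
    ((x.1.isSome ∧ (x.2.2 = (some (x.2.1 = a), none) ∨ x.2.2 = (none, some (x.2.1 = a)))))}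

theorem isBuchiRecognizable_exists_branch {A : Type*} (a : A) :
    IsBuchiRecognizable {t : InfTree A | ∃ d, a ∈ infOften (path t d)} := by
  classical
  convert (branchAutomaton a).isBuchiRecognizable {none, some True} using 1
  ext t
  constructor
  · rintro ⟨d, hd⟩
    let ρ : InfTree (Option Prop) := fun u =>
      if u = branchNode d u.length then some (∃ v b, u = v ++ [b] ∧ t v = a) else none
    have hsucc : ∀ u b, ρ (u ++ [b]) =
        if u = branchNode d u.length ∧ b = d u.length then some (t u = a) else none := by
      intro u b
      simp only [ρ, List.length_append, List.length_cons, List.length_nil, zero_add,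
        branchNode_succ]
      have : (u ++ [b] = branchNode d u.length ++ [d u.length]) ↔
          u = branchNode d u.length ∧ b = d u.length := by
        constructor
        · intro h
          have := List.append_inj' h rfl
          simpa using this
        · rintro ⟨h1, h2⟩
          rw [← h1, h2]
      simp only [this]
      congr 2
      apply propext
      constructor
      · rintro ⟨v, c, h, hv⟩
        rw [(List.append_inj' h rfl).1]; exact hv
      · exact fun h => ⟨u, b, rfl, h⟩
    refine ⟨ρ, ⟨?_, ?_⟩, fun e => ?_⟩
    · simp [ρ, branchAutomaton]
    · intro u
      simp only [hsucc]
      by_cases hu : u = branchNode d u.length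
      · right
        refine ⟨?_, ?_⟩
        · show (ρ u).isSome
          simp only [ρ]; rw [if_pos hu]; rfl
        · show ((_, _) : Option Prop × Option Prop) = _ ∨ ((_, _) : Option Prop × Option Prop) = _
          cases hb : d u.length <;> simp [← hu]
      · left
        refine ⟨?_, ?_⟩
        · show ρ u = none
          simp only [ρ]; rw [if_neg hu]
        · simp [hu]
    · by_cases hde : e = d
      · subst hde
        refine ⟨some True, by simp, ?_⟩
        rw [mem_infOften, frequently_atTop] at hd ⊢
        intro N
        obtain ⟨n, hn, h⟩ := hd N
        refine ⟨n + 1, by omega, ?_⟩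
        show ρ _ = _
        rw [branchNode_succ, hsucc, if_pos (by simp)]
        have h : t (branchNode e n) = a := h
        simp [h]
      · obtain ⟨i, hi⟩ := Function.ne_iff.1 hde
        -- A branch other than `d` leaves it for good, and from then on the state is `none`.
        refine ⟨none, by simp, Eventually.frequently ?_⟩
        filter_upwards [eventually_gt_atTop i] with n hn
        show ρ _ = none
        simp only [ρ, length_branchNode]
        exact if_neg fun h => hi (branchNode_injective h i hn)
  · rintro ⟨ρ, ⟨h0, h1⟩, h2⟩
    -- Exactly one child of a node on the guessed branch has a state of the form `some b`; following
    -- it recovers the branch.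
    obtain ⟨d, hd⟩ := exists_branch fun u => (ρ (u ++ [true])).isSome
    refine ⟨d, ?_⟩
    have hstep : ∀ u, (ρ u).isSome →
        ρ (u ++ [(ρ (u ++ [true])).isSome]) = some (t u = a) := by
      intro u hu
      rcases h1 u with ⟨h, -⟩ | ⟨-, h | h⟩
      · have h : ρ u = none := h
        simp [h] at hu
      · have h : (ρ (u ++ [false]), ρ (u ++ [true])) = (some (t u = a), none) := h
        simp_all
      · have h : (ρ (u ++ [false]), ρ (u ++ [true])) = (none, some (t u = a)) := h
        simp_all
    have hs : ∀ n, path ρ d (n + 1) = some (path t d n = a) := by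
      have : ∀ n, (path ρ d n).isSome := by
        intro n
        induction n with
        | zero => simp [path, h0, branchAutomaton]
        | succ n ih =>
          have := hstep _ ih
          rw [← hd, ← branchNode_succ] at this
          simp [path, this]
      intro n
      have := hstep _ (this n)
      rwa [← hd, ← branchNode_succ] at this
    obtain ⟨q, hq, hq'⟩ := h2 d
    rw [← infOften_shift _ 1] at hq'
    refine hq'.mono fun n hn => ?_
    have hn : path ρ d (n + 1) = q := hn
    rw [hs] at hn
    subst hn
    simpa using hq

end InfinitelyOften

/-! ### The complement of this language is not analytic. -/

section NotAnalytic

/-- The branches that turn right infinitely often. -/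
def infinitelyRight : Set (ℕ → Bool) := {d | ∃ᶠ n in atTop, d n = true}

/-- The sequence of gaps between the successive right turns of a branch. -/
noncomputable def gaps (d : ℕ → Bool) (i : ℕ) : ℕ :=
  Nat.nth (fun m => d m = true) (i + 1) - Nat.nth (fun m => d m = true) i - 1

theorem infinite_of_mem_infinitelyRight {d : ℕ → Bool} (hd : d ∈ infinitelyRight) :
    {m | d m = true}.Infinite := Nat.frequently_atTop_iff_infinite.1 hd

/-- A right turn and the number of right turns before it depend only on the branch up to that point.
Hence `gaps` is continuous where it codes sequences of naturals by branches. -/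
theorem nth_eq_of_agree {d e : ℕ → Bool} (hd : d ∈ infinitelyRight) (k : ℕ)
    (h : ∀ i ≤ Nat.nth (fun m => d m = true) k, e i = d i) :
    Nat.nth (fun m => e m = true) k = Nat.nth (fun m => d m = true) k := by
  set n := Nat.nth (fun m => d m = true) k with hn
  have h1 : d n = true := Nat.nth_mem_of_infinite (infinite_of_mem_infinitelyRight hd) k
  have h2 : Nat.count (fun m => d m = true) n = k :=
    Nat.count_nth_of_infinite (infinite_of_mem_infinitelyRight hd) k
  have h3 : Nat.count (fun m => e m = true) n = k := by
    rw [← h2, Nat.count_eq_card_filter_range, Nat.count_eq_card_filter_range]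
    congr 1
    refine Finset.filter_congr fun i hi => ?_
    rw [h i (Finset.mem_range.1 hi).le]
  have := Nat.nth_count (p := fun m => e m = true) (n := n) (by rw [h n le_rfl]; exact h1)
  rwa [h3] at this

theorem eventually_eq_of_discrete {X Y : Type*} [TopologicalSpace Y] [DiscreteTopology Y]
    {l : Filter X} {f : X → Y} {y : Y} (h : Tendsto f l (𝓝 y)) : ∀ᶠ x in l, f x = y := by
  rw [nhds_discrete] at h
  exact tendsto_pure.1 h

theorem eventually_agree (d : ℕ → Bool) (n : ℕ) : ∀ᶠ e in 𝓝 d, ∀ i ≤ n, e i = d i := by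
  have : ∀ i ∈ Finset.range (n + 1), ∀ᶠ e : ℕ → Bool in 𝓝 d, e i = d i := fun i _ =>
    eventually_eq_of_discrete (continuous_apply i).continuousAt.tendsto
  filter_upwards [(Finset.eventually_all _).2 this] with e he i hi
  exact he i (Finset.mem_range.2 (by omega))

theorem continuousOn_gaps : ContinuousOn gaps infinitelyRight := by
  rw [continuousOn_pi]
  intro i d hd
  refine ContinuousAt.continuousWithinAt ?_
  refine tendsto_nhds_of_eventually_eq ?_
  filter_upwards [eventually_agree d (Nat.nth (fun m => d m = true) (i + 1))] with e he
  have h1 := nth_eq_of_agree hd (i + 1) he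
  have h2 := nth_eq_of_agree hd i fun j hj => he j
    (hj.trans (Nat.nth_monotone (infinite_of_mem_infinitelyRight hd) (by omega)))
  unfold gaps
  rw [h1, h2]

theorem exists_gaps_eq (z : ℕ → ℕ) : ∃ d ∈ infinitelyRight, gaps d = z := by
  classical
  -- The right turns are placed at the positions `w i`, with `z i` left turns between consecutive
  -- ones.
  let w : ℕ → ℕ := fun i => ∑ j ∈ Finset.range i, (z j + 1)
  have hw1 : ∀ i, w (i + 1) = w i + (z i + 1) := fun i => Finset.sum_range_succ _ _
  have hw : StrictMono w := strictMono_nat_of_lt_succ fun i => by rw [hw1]; omega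
  let d : ℕ → Bool := fun m => decide (m ∈ range w)
  have hset : {m | d m = true} = range w := by ext m; simp [d]
  have hinf : {m | d m = true}.Infinite := by
    rw [hset]; exact infinite_range_of_injective hw.injective
  have hnth : Nat.nth (fun m => d m = true) = w := by
    refine ((Nat.nth_strictMono hinf).range_inj hw).1 ?_
    rw [Nat.range_nth_of_infinite hinf]
    exact hset
  refine ⟨d, Nat.frequently_atTop_iff_infinite.2 hinf, funext fun i => ?_⟩
  unfold gaps
  rw [hnth, hw1]
  omega

theorem exists_selfReferential {A : Type*} [Nonempty A] (G : Node → InfTree A → A)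
    (hG : ∀ u t t', (∀ v : Node, v.length < u.length → t v = t' v) → G u t = G u t') :
    ∃ t : InfTree A, ∀ u, t u = G u t := by
  let wf := (measure (List.length : Node → ℕ)).wf
  let step : (u : Node) → ((v : Node) → v.length < u.length → A) → A := fun u rec =>
    G u fun v => if h : v.length < u.length then rec v h else Classical.arbitrary A
  let t : InfTree A := wf.fix step
  refine ⟨t, fun u => ?_⟩
  have : t u = step u fun v _ => t v := wf.fix_eq step u
  rw [this]
  exact hG _ _ _ fun v hv => dif_pos hv

/-- Diagonalization: from a continuous parametrization `f` of the set one builds a tree `t` which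
has a branch with infinitely many `a` exactly when it belongs to the range of `f`. -/
theorem not_analyticSet_no_branch {A : Type*} {a b : A} (hab : a ≠ b) :
    ¬ @MeasureTheory.AnalyticSet (InfTree A) (cantorTopology A)
      {t | ∃ d, a ∈ infOften (path t d)}ᶜ := by
  classical
  let : TopologicalSpace A := ⊥
  have : DiscreteTopology A := ⟨rfl⟩
  have : Nonempty A := ⟨a⟩
  intro h
  rw [MeasureTheory.AnalyticSet] at h
  rcases h with h | ⟨f, hf, hrange⟩
  · have : (fun _ => b : InfTree A) ∈ {t | ∃ d, a ∈ infOften (path t d)}ᶜ := by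
      rintro ⟨d, hd⟩
      obtain ⟨n, hn⟩ := hd.exists
      exact hab hn.symm
    rw [h] at this
    exact this
  · let F : (ℕ → Bool) → InfTree A := f ∘ gaps
    have hF : ContinuousOn F infinitelyRight := hf.comp_continuousOn continuousOn_gaps
    -- Whether `u` is marked depends only on the labels at shorter nodes, so a tree whose `a`-nodes
    -- are exactly its own marked nodes can be defined by recursion on the length.
    let mark : Node → InfTree A → Prop := fun u t => ∃ d ∈ infinitelyRight,
      u = branchNode d u.length ∧ (∃ v, u = v ++ [true]) ∧
        ∀ v : Node, v.length < u.length → F d v = t v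
    obtain ⟨t, ht⟩ := exists_selfReferential (fun u t => if mark u t then a else b) (by
      intro u t t' htt'
      have : mark u t ↔ mark u t' := by
        refine exists_congr fun d => and_congr_right fun _ => and_congr_right fun _ =>
          and_congr_right fun _ => forall_congr' fun v => forall_congr' fun hv => ?_
        rw [htt' v hv]
      simp only [this])
    have hta : ∀ u, t u = a ↔ mark u t := fun u => by
      rw [ht u]
      by_cases hm : mark u t <;> simp [hm, hab.symm]
    have key : (∃ d, a ∈ infOften (path t d)) ↔ t ∈ range f := by
      constructor
      · rintro ⟨d, hd⟩
        have hm : ∃ᶠ n in atTop, mark (branchNode d n) t := hd.mono fun n hn => (hta _).1 hn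
        have hdr : d ∈ infinitelyRight := by
          rw [infinitelyRight, mem_ofPred_eq, frequently_atTop]
          intro N
          obtain ⟨n, hn, e, -, -, ⟨v, hv⟩, -⟩ := frequently_atTop.1 hm (N + 1)
          obtain ⟨n, rfl⟩ : ∃ m, n = m + 1 := ⟨n - 1, by omega⟩
          rw [branchNode_succ] at hv
          exact ⟨n, by omega, by simpa using (List.append_inj' hv rfl).2⟩
        -- The marks on `d` provide branches converging to `d` whose images agree with `t` on ever
        -- more levels; continuity gives `F d = t`.
        refine ⟨gaps d, funext fun v => ?_⟩
        have hcv : ContinuousWithinAt (fun e => F e v) infinitelyRight d :=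
          (continuous_apply v).continuousAt.comp_continuousWithinAt (hF d hdr)
        have hev : ∀ᶠ e in 𝓝[infinitelyRight] d, F e v = F d v :=
          eventually_eq_of_discrete hcv.tendsto
        rw [eventually_nhdsWithin_iff, nhds_pi] at hev
        obtain ⟨N, hN⟩ : ∃ N, ∀ e ∈ infinitelyRight, (∀ i < N, e i = d i) → F e v = F d v := by
          obtain ⟨I, hI, s, hs, hsub⟩ := Filter.mem_pi.1 hev
          obtain ⟨N, hN⟩ := hI.bddAbove
          refine ⟨N + 1, fun e he hagree => hsub (fun i hi => ?_) he⟩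
          rw [hagree i (Nat.lt_succ_of_le (hN hi))]
          exact mem_of_mem_nhds (hs i)
        obtain ⟨n, hn, e, he, hne, -, hagree⟩ := frequently_atTop.1 hm (max N (v.length + 1))
        rw [length_branchNode] at hne hagree
        have hN' := hN e he fun i hi => (branchNode_injective hne i (by omega)).symm
        show F d v = t v
        rw [← hN', hagree v (by omega)]
      · rintro ⟨z, hz⟩
        obtain ⟨d, hd, rfl⟩ := exists_gaps_eq z
        refine ⟨d, ?_⟩
        rw [mem_infOften, frequently_atTop]
        intro N
        obtain ⟨n, hn, hdn⟩ := frequently_atTop.1 hd N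
        -- Since `F d = t`, the branch `d` itself witnesses the mark after each of its right turns.
        refine ⟨n + 1, by omega, (hta _).2 ⟨d, hd, by simp, ⟨branchNode d n, ?_⟩, fun v _ => ?_⟩⟩
        · rw [branchNode_succ, hdn]
        · exact congrFun hz v
    rw [hrange] at key
    exact (iff_not_self key).elim

/-- A topology finer than the product topology in which the set of the trees without a branch
with infinitely many `a` is closed is no continuous image of the Baire space. -/
theorem not_exists_continuous_surjective {A : Type*} {a b : A} (hab : a ≠ b)
    (τ : TopologicalSpace (InfTree A)) (hτ : τ ≤ cantorTopology A)
    (hL : IsOpen[τ] {t | ∃ d, a ∈ infOften (path t d)}) :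
    ¬ ∃ g : (ℕ → ℕ) → InfTree A, Continuous[_, τ] g ∧ Function.Surjective g := by
  rintro ⟨g, hg, hsurj⟩
  refine not_analyticSet_no_branch hab ?_
  have hcl : IsClosed (g ⁻¹' {t | ∃ d, a ∈ infOften (path t d)}ᶜ) :=
    (@IsOpen.preimage _ _ _ τ g hg _ hL).isClosed_compl
  have hg' : Continuous[_, cantorTopology A] g := continuous_le_rng hτ hg
  have := @MeasureTheory.AnalyticSet.image_of_continuous _ _ _ (cantorTopology A) _
    hcl.analyticSet g hg'
  rwa [image_preimage_eq _ hsurj] at this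

end NotAnalytic

/-! ### Strong Choquet spaces as images of the Baire space. -/

section StrongChoquet

theorem ChoquetStrategy.answer_eq {X : Type*} (σ : ChoquetStrategy X) (U : ℕ → Set X) (x : ℕ → X)
    (n : ℕ) : σ.answer U x n = σ (List.ofFn (fun i : Fin n => (U i, x i)) ++ [(U n, x n)]) := by
  rw [ChoquetStrategy.answer, List.ofFn_succ', List.concat_eq_append]
  rfl

/-- A second countable metrizable strong Choquet space is a continuous image of the Baire
space. -/
theorem IsStrongChoquet.exists_nat_nat_continuous_surjective {X : Type*} [TopologicalSpace X]
    [TopologicalSpace.MetrizableSpace X] [SecondCountableTopology X] (h : IsStrongChoquet X) :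
    ∃ g : (ℕ → ℕ) → X, Continuous g ∧ Function.Surjective g := by
  classical
  obtain ⟨⟨x₀⟩, σ, hσ⟩ := h
  let := TopologicalSpace.metrizableSpaceMetric X
  let W : List (Set X × X) → Set X := fun p => if p = [] then univ else σ p
  -- The radii `(1/2)^n` force the diameters of the answers to tend to `0`, so that each sequence of
  -- choices determines a single point.
  let U : List (Set X × X) → X → Set X := fun p x =>
    W p ∩ Metric.ball x ((1 / 2 : ℝ) ^ p.length)
  let ext : List (Set X × X) → X → List (Set X × X) := fun p x => p ++ [(U p x, x)]
  have hWext : ∀ p x, W (ext p x) = σ (ext p x) := fun p x => if_neg (by simp [ext])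
  -- a position is good if the moves of Player 1 that `ext` describes are answered legally
  let Good : List (Set X × X) → Prop := fun p => (W p).Nonempty ∧
    ∀ x ∈ W p, IsOpen (W (ext p x)) ∧ x ∈ W (ext p x) ∧ W (ext p x) ⊆ U p x
  -- By the Lindelöf property, countably many moves of Player 1 receive answers that cover `W p`;
  -- their enumeration `e` is what a point of the Baire space indexes.
  have hex : ∀ p, ∃ e : ℕ → X, Good p → (∀ k, e k ∈ W p) ∧ W p ⊆ ⋃ k, W (ext p (e k)) := by
    intro p
    by_cases hp : Good p
    · obtain ⟨T, hTW, hTc, hT⟩ := TopologicalSpace.isOpen_biUnion_countable (W p)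
        (fun x => W (ext p x)) (fun x hx => (hp.2 x hx).1)
      have hcov : W p ⊆ ⋃ x ∈ T, W (ext p x) := by
        rw [hT]
        exact fun x hx => mem_biUnion hx (hp.2 x hx).2.1
      have hTne : T.Nonempty := by
        obtain ⟨x, hx⟩ := hp.1
        obtain ⟨y, hy, -⟩ := mem_iUnion₂.1 (hcov hx)
        exact ⟨y, hy⟩
      obtain ⟨e, he⟩ := hTc.exists_eq_range hTne
      refine ⟨e, fun _ => ⟨fun k => hTW (he ▸ mem_range_self k), ?_⟩⟩
      rw [he, biUnion_range] at hcov
      exact hcov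
    · exact ⟨fun _ => x₀, fun h => absurd h hp⟩
  choose e he using hex
  let pos : (ℕ → ℕ) → ℕ → List (Set X × X) := fun z n =>
    Nat.rec [] (fun n p => ext p (e p (z n))) n
  have pos_succ : ∀ z n, pos z (n + 1) = ext (pos z n) (e (pos z n) (z n)) := fun z n => rfl
  have pos_length : ∀ z n, (pos z n).length = n := by
    intro z n
    induction n with
    | zero => rfl
    | succ n ih => rw [pos_succ]; simp [ext, ih]
  have pos_congr : ∀ z z' n, (∀ i < n, z i = z' i) → pos z n = pos z' n := by
    intro z z' n
    induction n with
    | zero => intro _; rfl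
    | succ n ih =>
      intro h
      rw [pos_succ, pos_succ, ih fun i hi => h i (by omega), h n (by omega)]
  -- the play in which Player 1 follows `z` for `n` rounds and plays `y` at round `n`
  have legal : ∀ n z, (∀ i < n, e (pos z i) (z i) ∈ W (pos z i)) → (∀ i < n, Good (pos z i)) →
      Good (pos z n) := by
    intro n z hmem hgood
    have main : ∀ y ∈ W (pos z n), IsOpen (W (ext (pos z n) y)) ∧ y ∈ W (ext (pos z n) y) ∧
        W (ext (pos z n) y) ⊆ U (pos z n) y := by
      intro y hy
      let xs : ℕ → X := fun i => if i < n then e (pos z i) (z i) else y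
      let Us : ℕ → Set X := fun i => U (pos z i) (xs i)
      have hpos : ∀ m ≤ n, List.ofFn (fun i : Fin m => (Us i, xs i)) = pos z m := by
        intro m
        induction m with
        | zero => intro _; rfl
        | succ m ih =>
          intro hm
          rw [List.ofFn_succ', List.concat_eq_append, pos_succ]
          have := ih (by omega)
          simp only [Fin.val_castSucc, Fin.val_last]
          rw [this]
          have hx : xs m = e (pos z m) (z m) := if_pos (by omega)
          simp only [ext, Us, hx]
      have hans : ∀ m < n, σ.answer Us xs m = W (pos z (m + 1)) := by
        intro m hm
        have hx : xs m = e (pos z m) (z m) := if_pos hm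
        rw [ChoquetStrategy.answer_eq, hpos m hm.le, pos_succ, hWext]
        simp only [ext, Us, hx]
      have hans' : σ.answer Us xs n = W (ext (pos z n) y) := by
        have hx : xs n = y := if_neg (lt_irrefl n)
        rw [ChoquetStrategy.answer_eq, hpos n le_rfl, hWext]
        simp only [ext, Us, hx]
      have hopen : ∀ i ≤ n, IsOpen (W (pos z i)) := by
        intro i hi
        cases i with
        | zero => exact isOpen_univ
        | succ i => rw [pos_succ]; exact ((hgood i (by omega)).2 _ (hmem i (by omega))).1
      have hxmem : ∀ i ≤ n, xs i ∈ W (pos z i) := by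
        intro i hi
        rcases hi.lt_or_eq with hlt | rfl
        · have hx : xs i = e (pos z i) (z i) := if_pos hlt
          rw [hx]; exact hmem i hlt
        · have hx : xs i = y := if_neg (lt_irrefl i)
          rw [hx]; exact hy
      have := (hσ Us xs).1 n (fun i hi => ⟨(hopen i hi).inter Metric.isOpen_ball,
        ⟨hxmem i hi, Metric.mem_ball_self (by positivity)⟩, fun m hm => by
          subst hm
          rw [hans m (by omega)]
          exact inter_subset_left⟩)
      have hx : xs n = y := if_neg (lt_irrefl n)
      rw [hans', hx] at this
      refine ⟨this.1, this.2.1, this.2.2.trans ?_⟩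
      simp only [Us, hx]
      exact subset_rfl
    refine ⟨?_, main⟩
    cases n with
    | zero => exact ⟨x₀, mem_univ _⟩
    | succ n =>
      exact ⟨_, ((hgood n (by omega)).2 _ (hmem n (by omega))).2.1⟩
  have good : ∀ z n, Good (pos z n) ∧ e (pos z n) (z n) ∈ W (pos z n) := by
    intro z n
    induction n using Nat.strong_induction_on with
    | _ n ih =>
      have hg := legal n z (fun i hi => (ih i hi).2) (fun i hi => (ih i hi).1)
      exact ⟨hg, ((he _ hg).1 _)⟩
  have hne : ∀ z, (⋂ n, W (pos z (n + 1))).Nonempty := by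
    intro z
    let xs : ℕ → X := fun i => e (pos z i) (z i)
    let Us : ℕ → Set X := fun i => U (pos z i) (xs i)
    have hpos : ∀ m, List.ofFn (fun i : Fin m => (Us i, xs i)) = pos z m := by
      intro m
      induction m with
      | zero => rfl
      | succ m ih =>
        rw [List.ofFn_succ', List.concat_eq_append, pos_succ]
        simp only [Fin.val_castSucc, Fin.val_last]
        rw [ih]
    have hans : ∀ m, σ.answer Us xs m = W (pos z (m + 1)) := by
      intro m
      rw [ChoquetStrategy.answer_eq, hpos m, pos_succ, hWext]
    have := (hσ Us xs).2 fun n => ⟨?_, ⟨(good z n).2, Metric.mem_ball_self (by positivity)⟩,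
        fun m hm => ?_⟩
    · simpa only [hans] using this
    · refine IsOpen.inter ?_ Metric.isOpen_ball
      cases n with
      | zero => exact isOpen_univ
      | succ i => rw [pos_succ]; exact ((good z i).1.2 _ (good z i).2).1
    · subst hm
      rw [hans m]
      exact inter_subset_left
  choose g hg using hne
  have hg' : ∀ z n, g z ∈ W (pos z (n + 1)) := fun z n => mem_iInter.1 (hg z) n
  have hdiam : ∀ z n, ∀ x ∈ W (pos z (n + 1)), ∀ y ∈ W (pos z (n + 1)),
      dist x y < 2 * (1 / 2 : ℝ) ^ n := by
    intro z n x hx y hy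
    rw [pos_succ] at hx hy
    have hsub := ((good z n).1.2 _ (good z n).2).2.2
    have h1 := Metric.mem_ball.1 (hsub hx).2
    have h2 := Metric.mem_ball'.1 (hsub hy).2
    rw [pos_length] at h1 h2
    linarith [dist_triangle x (e (pos z n) (z n)) y]
  have hlim : ∀ ε > 0, ∃ n, 2 * (1 / 2 : ℝ) ^ n < ε := by
    intro ε hε
    obtain ⟨n, hn⟩ := exists_pow_lt_of_lt_one (half_pos hε) (by norm_num : (1 / 2 : ℝ) < 1)
    exact ⟨n, by linarith⟩
  refine ⟨g, ?_, fun y => ?_⟩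
  · rw [continuous_iff_continuousAt]
    intro z
    rw [ContinuousAt, Metric.tendsto_nhds]
    intro ε hε
    obtain ⟨n, hn⟩ := hlim ε hε
    have : ∀ i ∈ Finset.range (n + 1), ∀ᶠ z' : ℕ → ℕ in 𝓝 z, z' i = z i := fun i _ =>
      eventually_eq_of_discrete (continuous_apply i).continuousAt.tendsto
    filter_upwards [(Finset.eventually_all _).2 this] with z' hz'
    have hp := pos_congr z' z (n + 1) fun i hi => hz' i (Finset.mem_range.2 hi)
    exact (hdiam z n _ (hp ▸ hg' z' n) _ (hg' z n)).trans hn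
  -- At every position some member of the countable cover contains `y`; the indices of such members
  -- form a preimage of `y`.
  · have hnext : ∀ p : List (Set X × X), ∃ k, Good p → y ∈ W p → y ∈ W (ext p (e p k)) := by
      intro p
      by_cases hp : Good p ∧ y ∈ W p
      · obtain ⟨k, hk⟩ := mem_iUnion.1 ((he p hp.1).2 hp.2)
        exact ⟨k, fun _ _ => hk⟩
      · exact ⟨0, fun h1 h2 => absurd ⟨h1, h2⟩ hp⟩
    choose κ hκ using hnext
    let q : ℕ → List (Set X × X) := fun n => Nat.rec [] (fun n p => ext p (e p (κ p))) n
    let z : ℕ → ℕ := fun n => κ (q n)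
    have hq : ∀ n, pos z n = q n := by
      intro n
      induction n with
      | zero => rfl
      | succ n ih => rw [pos_succ, ih]
    have hy : ∀ n, y ∈ W (pos z n) := by
      intro n
      induction n with
      | zero => exact mem_univ _
      | succ n ih =>
        have := hκ _ (good z n).1 ih
        rw [pos_succ]
        rwa [show z n = κ (pos z n) by rw [hq]]
    refine ⟨z, ?_⟩
    by_contra hne
    obtain ⟨n, hn⟩ := hlim _ (dist_pos.2 hne)
    exact lt_irrefl _ ((hdiam z n _ (hg' z n) _ (hy (n + 1))).trans hn)

end StrongChoquet

/-! ### Strategies of Player 2 given by states. -/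

section Game

/-- Player 2 wins the strong Choquet game if it can maintain states `s` which describe open
sets `V s`, in such a way that every infinite sequence of states related by `R` describes
sets with a common point. -/
theorem isStrongChoquet_of_states {X St : Type*} [TopologicalSpace X] [Nonempty X]
    (V : St → Set X) (s₀ : St) (hs₀ : V s₀ = univ) (R : St → St → Prop)
    (step : ∀ s U x, IsOpen U → x ∈ U → U ⊆ V s →
      ∃ s', R s s' ∧ IsOpen (V s') ∧ x ∈ V s' ∧ V s' ⊆ U)
    (lim : ∀ s : ℕ → St, (∀ n, R (s n) (s (n + 1))) → (⋂ n, V (s n)).Nonempty) :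
    IsStrongChoquet X := by
  classical
  have : ∀ s U x, ∃ s', IsOpen U → x ∈ U → U ⊆ V s →
      R s s' ∧ IsOpen (V s') ∧ x ∈ V s' ∧ V s' ⊆ U := by
    intro s U x
    by_cases h : IsOpen U ∧ x ∈ U ∧ U ⊆ V s
    · obtain ⟨s', hs'⟩ := step s U x h.1 h.2.1 h.2.2
      exact ⟨s', fun _ _ _ => hs'⟩
    · exact ⟨s, fun h1 h2 h3 => absurd ⟨h1, h2, h3⟩ h⟩
  choose next hnext using this
  let run : List (Set X × X) → St := fun l => l.foldl (fun s m => next s m.1 m.2) s₀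
  refine ⟨inferInstance, fun l => V (run l), fun U x => ?_⟩
  let s : ℕ → St := fun n => run (List.ofFn fun i : Fin n => (U i, x i))
  have hs : ∀ n, s (n + 1) = next (s n) (U n) (x n) := by
    intro n
    simp only [s, run]
    rw [List.ofFn_succ', List.concat_eq_append, List.foldl_append]
    rfl
  have hans : ∀ n, ChoquetStrategy.answer (fun l => V (run l)) U x n = V (s (n + 1)) :=
    fun n => rfl
  have key : ∀ n, ChoquetStrategy.LegalMove (fun l => V (run l)) U x n →
      R (s n) (s (n + 1)) ∧ IsOpen (V (s (n + 1))) ∧ x n ∈ V (s (n + 1)) ∧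
        V (s (n + 1)) ⊆ U n := by
    rintro n ⟨h1, h2, h3⟩
    rw [hs]
    refine hnext _ _ _ h1 h2 ?_
    cases n with
    | zero =>
      have : s 0 = s₀ := rfl
      rw [this, hs₀]
      exact subset_univ _
    | succ n => exact h3 n rfl
  refine ⟨fun n hn => (key n (hn n le_rfl)).2, fun h => ?_⟩
  obtain ⟨y, hy⟩ := lim s fun n => (key n (h n)).1
  exact ⟨y, mem_iInter.2 fun n => mem_iInter.1 hy (n + 1)⟩

end Game

/-! ### The Büchi topology is strong Choquet. -/

section Buchi

/-- Compactness of the space of branches: the branches with a visit to `F` between levels `n` and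
`m` form an open set, which increases with `m`, and these sets cover the space. -/
theorem exists_uniform_visit {Q : Type*} {ρ : InfTree Q} {F : Set Q}
    (h : ∀ d, ∃ q ∈ F, q ∈ infOften (path ρ d)) (n : ℕ) :
    ∃ m, ∀ d, ∃ k, n ≤ k ∧ k < m ∧ ρ (branchNode d k) ∈ F := by
  let O : ℕ → Set (ℕ → Bool) := fun m => {d | ∃ k, n ≤ k ∧ k < m ∧ ρ (branchNode d k) ∈ F}
  have hO : ∀ m, IsOpen (O m) := by
    intro m
    rw [isOpen_iff_mem_nhds]
    rintro d ⟨k, h1, h2, h3⟩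
    filter_upwards [eventually_agree d k] with e he
    refine ⟨k, h1, h2, ?_⟩
    have : branchNode e k = branchNode d k := by
      unfold branchNode
      congr 1
      funext i
      exact he i i.2.le
    rwa [this]
  have hcov : (univ : Set (ℕ → Bool)) ⊆ ⋃ m, O m := by
    intro d _
    obtain ⟨q, hq, hq'⟩ := h d
    obtain ⟨k, hk, hkq⟩ := frequently_atTop.1 hq' n
    exact mem_iUnion.2 ⟨k + 1, k, hk, Nat.lt_succ_self k, by
      have : ρ (branchNode d k) = q := hkq
      rwa [this]⟩
  obtain ⟨m, hm⟩ := isCompact_univ.elim_directed_cover O hO hcov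
    (directed_of_isDirected_le fun a b hab d ⟨k, h1, h2, h3⟩ => ⟨k, h1, h2.trans_le hab, h3⟩)
  exact ⟨m, fun d => hm (mem_univ d)⟩

/-- A tree with accepting runs of finitely many Büchi automata on it, and a depth up to which
the tree and the runs are fixed. -/
structure BuchiState (A : Type*) where
  depth : ℕ
  tree : InfTree A
  autos : Set (FinBuchi A)
  runs : (α : FinBuchi A) → InfTree (Fin α.1)
  finite : autos.Finite
  accepting : ∀ α ∈ autos, α.2.1.IsAcceptingRun α.2.2 tree (runs α)

/-- The trees that agree with the fixed part of the state `s`. -/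
def BuchiState.carrier {A : Type*} (s : BuchiState A) : Set (InfTree A) :=
  {t | (∀ u : Node, u.length < s.depth → t u = s.tree u) ∧ ∀ α ∈ s.autos,
    ∃ ρ, α.2.1.IsAcceptingRun α.2.2 t ρ ∧ ∀ u : Node, u.length < s.depth → ρ u = s.runs α u}

/-- `s'` refines `s`, and between the depths of the two states all the automata of `s` visit
an accepting state on every branch. -/
structure BuchiState.Refines {A : Type*} (s s' : BuchiState A) : Prop where
  depth_lt : s.depth < s'.depth
  autos_subset : s.autos ⊆ s'.autos
  tree_eq : ∀ u : Node, u.length < s.depth → s'.tree u = s.tree u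
  runs_eq : ∀ α ∈ s.autos, ∀ u : Node, u.length < s.depth → s'.runs α u = s.runs α u
  visit : ∀ α ∈ s.autos, ∀ d, ∃ k, s.depth ≤ k ∧ k < s'.depth ∧
    s'.runs α (branchNode d k) ∈ α.2.2

theorem BuchiState.mem_carrier {A : Type*} (s : BuchiState A) : s.tree ∈ s.carrier :=
  ⟨fun _ _ => rfl, fun α hα => ⟨s.runs α, s.accepting α hα, fun _ _ => rfl⟩⟩

theorem BuchiState.isOpen_carrier {A : Type*} (s : BuchiState A) :
    IsOpen[buchiTopology A] s.carrier := by
  have : s.carrier = {t | ∀ u : Node, u.length < s.depth → t u = s.tree u} ∩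
      ⋂ α ∈ s.autos, {t | ∃ ρ, α.2.1.IsAcceptingRun α.2.2 t ρ ∧
        ∀ u : Node, u.length < s.depth → ρ u = s.runs α u} := by
    ext t; simp [carrier]
  rw [this]
  refine @IsOpen.inter _ (buchiTopology A) _ _ ?_ ?_
  · exact TopologicalSpace.isOpen_generateFrom_of_mem (isBuchiRecognizable_prefix _ _)
  · refine @Set.Finite.isOpen_biInter _ _ (buchiTopology A) _ _ s.finite fun α _ => ?_
    exact TopologicalSpace.isOpen_generateFrom_of_mem
      (isBuchiRecognizable_constrained α.2.1 α.2.2 s.depth fun u q _ => q = s.runs α u)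

theorem exists_finBuchi_subset {A : Type*} {U : Set (InfTree A)} (hU : IsOpen[buchiTopology A] U)
    {t : InfTree A} (ht : t ∈ U) : ∃ I : Set (FinBuchi A), I.Finite ∧
      (∀ α ∈ I, t ∈ α.2.1.buchiLanguage α.2.2) ∧
        ∀ t', (∀ α ∈ I, t' ∈ α.2.1.buchiLanguage α.2.2) → t' ∈ U := by
  have hB := @TopologicalSpace.isTopologicalBasis_of_subbasis _ (buchiTopology A) _ rfl
  obtain ⟨_, ⟨f, ⟨hf, hf'⟩, rfl⟩, htf, hfU⟩ :=
    @TopologicalSpace.IsTopologicalBasis.exists_subset_of_mem_open _ (buchiTopology A) _ hB _ _ ht hU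
  have : Nonempty (FinBuchi A) := ⟨⟨1, ⟨0, univ⟩, univ⟩⟩
  choose! α hα using fun L (hL : L ∈ f) => IsBuchiRecognizable.exists_finBuchi (hf' hL)
  refine ⟨α '' f, hf.image _, ?_, fun t' h => hfU ?_⟩
  · rintro _ ⟨L, hL, rfl⟩
    rw [← hα L hL]
    exact htf L hL
  · intro L hL
    rw [hα L hL]
    exact h _ (mem_image_of_mem _ hL)

/-- Membership of `t` in the old carrier gives runs on `t` that extend the fixed parts. Finitely
many automata certifying `t ∈ U` are added, and the depth grows until all old automata have visited
an accepting state on every branch. -/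
theorem BuchiState.exists_refines {A : Type*} (s : BuchiState A) {U : Set (InfTree A)}
    {t : InfTree A} (hU : IsOpen[buchiTopology A] U) (ht : t ∈ U) (hUs : U ⊆ s.carrier) :
    ∃ s' : BuchiState A, s.Refines s' ∧ t ∈ s'.carrier ∧ s'.carrier ⊆ U := by
  classical
  obtain ⟨I, hI, htI, hIU⟩ := exists_finBuchi_subset hU ht
  obtain ⟨htree, hruns⟩ := hUs ht
  have hex : ∀ α : FinBuchi A, ∃ ρ : InfTree (Fin α.1), α ∈ s.autos ∪ I →
      α.2.1.IsAcceptingRun α.2.2 t ρ ∧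
        (α ∈ s.autos → ∀ u : Node, u.length < s.depth → ρ u = s.runs α u) := by
    intro α
    by_cases h : α ∈ s.autos
    · obtain ⟨ρ, h1, h2⟩ := hruns α h
      exact ⟨ρ, fun _ => ⟨h1, fun _ => h2⟩⟩
    · by_cases h' : α ∈ I
      · obtain ⟨ρ, hρ⟩ := htI α h'
        exact ⟨ρ, fun _ => ⟨hρ, fun h'' => absurd h'' h⟩⟩
      · exact ⟨fun _ => α.2.1.init, fun h'' => (h''.elim h h').elim⟩
  choose ρ hρ using hex
  have hvis : ∀ α : FinBuchi A, ∃ m, α ∈ s.autos →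
      ∀ d, ∃ k, s.depth ≤ k ∧ k < m ∧ ρ α (branchNode d k) ∈ α.2.2 := by
    intro α
    by_cases h : α ∈ s.autos
    · obtain ⟨m, hm⟩ := exists_uniform_visit ((hρ α (Or.inl h)).1.2) s.depth
      exact ⟨m, fun _ => hm⟩
    · exact ⟨0, fun h' => absurd h' h⟩
  choose m hm using hvis
  -- There are finitely many automata, so one depth serves them all.
  obtain ⟨N, hN⟩ := (s.finite.image m).bddAbove
  let s' : BuchiState A :=
    { depth := max (s.depth + 1) N
      tree := t
      autos := s.autos ∪ I
      runs := ρ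
      finite := s.finite.union hI
      accepting := fun α hα => (hρ α hα).1 }
  refine ⟨s', ⟨?_, subset_union_left, htree, fun α hα => (hρ α (Or.inl hα)).2 hα,
    fun α hα d => ?_⟩, s'.mem_carrier, fun t' ht' => hIU t' fun α hα => ?_⟩
  · exact (Nat.lt_succ_self _).trans_le (le_max_left _ _)
  · obtain ⟨k, h1, h2, h3⟩ := hm α hα d
    exact ⟨k, h1, (h2.trans_le (hN (mem_image_of_mem m hα))).trans_le (le_max_right _ _), h3⟩
  · obtain ⟨ρ', h, -⟩ := ht'.2 α (Or.inr hα)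
    exact ⟨ρ', h⟩

/-- The fixed parts have unions that are a tree and a run of each automaton occurring. Every
refinement contributes a visit to an accepting state on each branch, so the limit runs are
accepting. -/
theorem BuchiState.nonempty_iInter {A : Type*} (s : ℕ → BuchiState A)
    (hs : ∀ n, (s n).Refines (s (n + 1))) : (⋂ n, (s n).carrier).Nonempty := by
  have hdepth : StrictMono fun n => (s n).depth := strictMono_nat_of_lt_succ fun n => (hs n).depth_lt
  have hautos : Monotone fun n => (s n).autos := monotone_nat_of_le_succ fun n => (hs n).autos_subset
  have htree : ∀ m n, m ≤ n → ∀ u : Node, u.length < (s m).depth → (s n).tree u = (s m).tree u := by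
    intro m n hmn u hu
    induction n, hmn using Nat.le_induction with
    | base => rfl
    | succ n hmn ih =>
      rw [(hs n).tree_eq u (hu.trans_le (hdepth.monotone hmn)), ih]
  have hruns : ∀ m n, m ≤ n → ∀ α ∈ (s m).autos, ∀ u : Node, u.length < (s m).depth →
      (s n).runs α u = (s m).runs α u := by
    intro m n hmn α hα u hu
    induction n, hmn using Nat.le_induction with
    | base => rfl
    | succ n hmn ih =>
      rw [(hs n).runs_eq α (hautos hmn hα) u (hu.trans_le (hdepth.monotone hmn)), ih]
  have hlt : ∀ (u : Node) n, u.length + 1 ≤ n → u.length < (s n).depth := fun u n h =>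
    h.trans (hdepth.id_le n)
  -- The depths increase strictly, so the state of index `u.length + 1` has already fixed the label
  -- at `u`.
  let t : InfTree A := fun u => (s (u.length + 1)).tree u
  have ht : ∀ n (u : Node), u.length < (s n).depth → t u = (s n).tree u := by
    intro n u hu
    rcases le_total n (u.length + 1) with h | h
    · exact htree _ _ h u hu
    · exact (htree _ _ h u (hlt u _ le_rfl)).symm
  refine ⟨t, mem_iInter.2 fun j => ⟨ht j, fun α hα => ?_⟩⟩
  -- Only from index `j` on is `α` known to be among the automata whose runs are maintained.
  let ρ : InfTree (Fin α.1) := fun u => (s (max j (u.length + 1))).runs α u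
  have hρ : ∀ n, j ≤ n → ∀ u : Node, u.length < (s n).depth → ρ u = (s n).runs α u := by
    intro n hn u hu
    rcases le_total n (max j (u.length + 1)) with h | h
    · exact hruns _ _ h α (hautos hn hα) u hu
    · exact (hruns _ _ h α (hautos (le_max_left _ _) hα) u
        (hlt u _ (le_max_right _ _))).symm
  refine ⟨ρ, ⟨⟨?_, fun u => ?_⟩, fun d => ?_⟩, hρ j le_rfl⟩
  · exact ((s _).accepting α (hautos (le_max_left _ _) hα)).1.1
  · have hn1 : j ≤ max j (u.length + 2) := le_max_left _ _
    have hn2 : u.length + 2 ≤ max j (u.length + 2) := le_max_right _ _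
    generalize max j (u.length + 2) = n at hn1 hn2
    rw [hρ n hn1 u (hlt u n (by omega)), ht n u (hlt u n (by omega)),
      hρ n hn1 _ (hlt _ n (by simp; omega)), hρ n hn1 _ (hlt _ n (by simp; omega))]
    exact ((s n).accepting α (hautos hn1 hα)).1.2 u
  · refine exists_mem_infOften (frequently_atTop.2 fun N => ?_)
    obtain ⟨k, h1, h2, h3⟩ := (hs (max j N)).visit α (hautos (le_max_left _ _) hα) d
    refine ⟨k, ((le_max_right j N).trans (hdepth.id_le _)).trans h1, ?_⟩
    show ρ (branchNode d k) ∈ _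
    rwa [hρ (max j N + 1) ((le_max_left _ _).trans (Nat.le_succ _)) _ (by simpa using h2)]

theorem isStrongChoquet_buchi (A : Type*) [Nonempty A] :
    @IsStrongChoquet (InfTree A) (buchiTopology A) := by
  have : Nonempty (InfTree A) := ⟨fun _ => Classical.arbitrary A⟩
  refine @isStrongChoquet_of_states _ _ (buchiTopology A) _ BuchiState.carrier
    ⟨0, fun _ => Classical.arbitrary A, ∅, fun α _ => α.2.1.init, finite_empty, by simp⟩ ?_
    BuchiState.Refines ?_ BuchiState.nonempty_iInter
  · ext t; simp [BuchiState.carrier]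
  · intro s U t hU ht hUs
    obtain ⟨s', h1, h2, h3⟩ := s.exists_refines hU ht hUs
    exact ⟨s', h1, s'.isOpen_carrier, h2, h3⟩

end Buchi

/-! ### Parity games with positional strategies for the second player. -/

section Parity

/-- The greatest number that occurs infinitely often is even. -/
def ParityGood (p : ℕ → ℕ) : Prop :=
  ∃ k, Even k ∧ (∃ᶠ n in atTop, p n = k) ∧ ∀ᶠ n in atTop, p n ≤ k

theorem parityGood_shift (p : ℕ → ℕ) (k : ℕ) : ParityGood (fun n => p (n + k)) ↔ ParityGood p := by
  refine exists_congr fun m => and_congr_right fun _ => and_congr ?_ ?_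
  · exact Set.ext_iff.1 (infOften_shift p k) m
  · exact ⟨fun h => by
      rw [eventually_atTop] at h ⊢
      obtain ⟨N, hN⟩ := h
      exact ⟨N + k, fun n hn => by
        simpa [Nat.sub_add_cancel (by omega : k ≤ n)] using hN (n - k) (by omega)⟩,
      fun h => (tendsto_add_atTop_nat k).eventually h⟩

theorem parityGood_const {m : ℕ} (hm : Even m) : ParityGood fun _ => m :=
  ⟨m, hm, Frequently.of_forall fun _ => rfl, Eventually.of_forall fun _ => le_rfl⟩

variable {V : Type*}

/-- The component of a pair that a direction selects. -/
def pick (m : V × V) (b : Bool) : V := if b then m.2 else m.1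

/-- The subtree of `f` below the child `b` of the root. -/
def subtree (f : InfTree V) (b : Bool) : InfTree V := fun u => f (b :: u)

/-- The branch that starts with the direction `b` and goes on with `d`. -/
def consBranch (b : Bool) (d : ℕ → Bool) : ℕ → Bool := fun n => Nat.casesOn n b d

theorem branchNode_cons (d : ℕ → Bool) (n : ℕ) :
    branchNode d (n + 1) = d 0 :: branchNode (fun i => d (i + 1)) n := by
  rw [branchNode, List.ofFn_succ]
  rfl

theorem path_consBranch (f : InfTree V) (b : Bool) (d : ℕ → Bool) (n : ℕ) :
    path f (consBranch b d) (n + 1) = path (subtree f b) d n := by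
  unfold path
  rw [branchNode_cons]
  rfl

/-- `f` is a run of the game in which the first player chooses at each vertex `v` a pair in
`moves v`, and the second player chooses a component of this pair, the next vertex; the
first player wins from `v` if the colors along all branches are good. -/
def RunWins (moves : V → Set (V × V)) (c : V → ℕ) (v : V) : Prop :=
  ∃ f : InfTree V, f [] = v ∧ (∀ u, (f (u ++ [false]), f (u ++ [true])) ∈ moves (f u)) ∧
    ∀ d, ParityGood fun n => c (path f d n)

/-- `p` is a play in which the second player follows the positional strategy `τ`. -/
def IsPlay (moves : V → Set (V × V)) (τ : V → V × V → Bool) (p : ℕ → V) : Prop :=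
  ∀ n, ∃ m ∈ moves (p n), p (n + 1) = pick m (τ (p n) m)

/-- The positional strategy `τ` of the second player wins from `v`. -/
def PositionalWins (moves : V → Set (V × V)) (c : V → ℕ) (τ : V → V × V → Bool) (v : V) : Prop :=
  ∀ p : ℕ → V, p 0 = v → IsPlay moves τ p → ¬ ParityGood fun n => c (p n)

theorem PositionalWins.step {moves : V → Set (V × V)} {c : V → ℕ} {τ : V → V × V → Bool} {v : V}
    (h : PositionalWins moves c τ v) {m : V × V} (hm : m ∈ moves v) :
    PositionalWins moves c τ (pick m (τ v m)) := by
  intro p h0 hp hgood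
  let q : ℕ → V := fun n => Nat.casesOn n v p
  refine h q rfl (fun n => ?_) ((parityGood_shift (fun n => c (q n)) 1).1 hgood)
  cases n with
  | zero => exact ⟨m, hm, h0⟩
  | succ n => exact hp n

/-- A strategy with memory `Z` for the first player. -/
theorem runWins_of_machine {moves : V → Set (V × V)} {c : V → ℕ} {Z : Type*} (out : Z → V)
    (next : Z → Bool → Z) (I : Set Z) (hI : ∀ z ∈ I, ∀ b, next z b ∈ I)
    (hmove : ∀ z ∈ I, (out (next z false), out (next z true)) ∈ moves (out z))
    (hgood : ∀ (zs : ℕ → Z) (d : ℕ → Bool), zs 0 ∈ I → (∀ n, zs (n + 1) = next (zs n) (d n)) →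
      ParityGood fun n => c (out (zs n))) {z : Z} (hz : z ∈ I) : RunWins moves c (out z) := by
  let S : Node → Z := fun u => u.foldl next z
  have hS : ∀ u b, S (u ++ [b]) = next (S u) b := fun u b => by simp [S]
  have hSI : ∀ u, S u ∈ I := fun u => by
    induction u using List.reverseRecOn with
    | nil => exact hz
    | append_singleton u b ih => rw [hS]; exact hI _ ih b
  refine ⟨fun u => out (S u), rfl, fun u => ?_, fun d => ?_⟩
  · simp only [hS]
    exact hmove _ (hSI u)
  · exact hgood (fun n => S (branchNode d n)) d (hSI _) fun n => by rw [branchNode_succ, hS]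

theorem runWins_of_move {moves : V → Set (V × V)} {c : V → ℕ} {v : V} {m : V × V}
    (hm : m ∈ moves v) (h1 : RunWins moves c m.1) (h2 : RunWins moves c m.2) :
    RunWins moves c v := by
  obtain ⟨f, hf0, hf, hfd⟩ := h1
  obtain ⟨g, hg0, hg, hgd⟩ := h2
  let k : InfTree V := fun u => match u with
    | [] => v
    | false :: u => f u
    | true :: u => g u
  refine ⟨k, rfl, fun u => ?_, fun d => ?_⟩
  · match u with
    | [] => simpa [k, hf0, hg0] using hm
    | false :: u => exact hf u
    | true :: u => exact hg u
  · rw [← parityGood_shift _ 1]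
    have : ∀ n, path k d (n + 1) =
        if d 0 then path g (fun i => d (i + 1)) n else path f (fun i => d (i + 1)) n := by
      intro n
      unfold path
      rw [branchNode_cons]
      cases d 0 <;> rfl
    simp only [this]
    cases d 0
    · exact hfd _
    · exact hgd _

theorem subtree_iterate {fs : ℕ → InfTree V} {d : ℕ → Bool}
    (h : ∀ n, fs (n + 1) = subtree (fs n) (d n)) (n : ℕ) (u : Node) :
    fs n u = fs 0 (branchNode d n ++ u) := by
  induction n generalizing u with
  | zero => simp
  | succ n ih =>
    rw [h, subtree, ih, branchNode_succ, List.append_assoc]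
    rfl

/-- `f` is a run until the set `T` is reached. -/
def RunUntil (moves : V → Set (V × V)) (c : V → ℕ) (T : Set V) (f : InfTree V) : Prop :=
  (∀ u, f u ∉ T → (f (u ++ [false]), f (u ++ [true])) ∈ moves (f u)) ∧
    ∀ d, (∃ k, path f d k ∈ T) ∨ ParityGood fun n => c (path f d n)

theorem RunUntil.subtree {moves : V → Set (V × V)} {c : V → ℕ} {T : Set V} {f : InfTree V}
    (h : RunUntil moves c T f) (h0 : f [] ∉ T) (b : Bool) :
    RunUntil moves c T (subtree f b) := by
  refine ⟨fun u hu => h.1 (b :: u) hu, fun d => ?_⟩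
  rcases h.2 (consBranch b d) with ⟨k, hk⟩ | h
  · left
    cases k with
    | zero => exact absurd (by simpa [path] using hk) h0
    | succ k => exact ⟨k, by rwa [path_consBranch] at hk⟩
  · right
    rw [← parityGood_shift _ 1] at h
    simpa only [path_consBranch] using h

/-- After reaching a vertex from which it can win, the first player plays to win. -/
theorem RunUntil.runWins {moves : V → Set (V × V)} {c : V → ℕ} {f : InfTree V}
    (h : RunUntil moves c {v | RunWins moves c v} f) : RunWins moves c (f []) := by
  classical
  set T := {v | RunWins moves c v} with hT
  by_cases hf : f [] ∈ T
  · exact hf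
  have : ∀ v, ∃ g : InfTree V, v ∈ T → g [] = v ∧
      (∀ u, (g (u ++ [false]), g (u ++ [true])) ∈ moves (g u)) ∧
        ∀ d, ParityGood fun n => c (path g d n) := by
    intro v
    by_cases hv : v ∈ T
    · obtain ⟨g, hg⟩ := hv
      exact ⟨g, fun _ => hg⟩
    · exact ⟨f, fun h => absurd h hv⟩
  choose g hg using this
  -- The Boolean tells whether `T` has been reached; at that moment the run is replaced by a winning
  -- run from the vertex reached.
  let next : Bool × InfTree V → Bool → Bool × InfTree V := fun z b =>
    if z.1 then (true, TreeTopology.subtree z.2 b)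
    else if z.2 [b] ∈ T then (true, g (z.2 [b])) else (false, TreeTopology.subtree z.2 b)
  let I : Set (Bool × InfTree V) := {z |
    (z.1 = true ∧ (∀ u, (z.2 (u ++ [false]), z.2 (u ++ [true])) ∈ moves (z.2 u)) ∧
      ∀ d, ParityGood fun n => c (path z.2 d n)) ∨
    (z.1 = false ∧ z.2 [] ∉ T ∧ RunUntil moves c T z.2)}
  have hout : ∀ z ∈ I, ∀ b, (next z b).2 [] = z.2 [b] := by
    rintro ⟨b, k⟩ - b'
    cases b
    · by_cases hk : k [b'] ∈ T
      · simp only [next, hk, if_true, Bool.false_eq_true, if_false]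
        exact (hg _ hk).1
      · simp [next, hk, TreeTopology.subtree]
    · simp [next, TreeTopology.subtree]
  have hnext : ∀ z ∈ I, ∀ b, next z b ∈ I := by
    rintro ⟨b, k⟩ hz b'
    rcases hz with ⟨rfl, h1, h2⟩ | ⟨rfl, h1, h2⟩
    · left
      refine ⟨rfl, fun u => h1 (b' :: u), fun d => ?_⟩
      have := h2 (consBranch b' d)
      rw [← parityGood_shift _ 1] at this
      simp only [path_consBranch] at this
      exact this
    · by_cases hk : k [b'] ∈ T
      · left
        simp only [next, hk, if_true, Bool.false_eq_true, if_false]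
        exact ⟨trivial, (hg _ hk).2⟩
      · right
        simp only [next, hk, Bool.false_eq_true, if_false]
        exact ⟨trivial, hk, h2.subtree h1 b'⟩
  refine runWins_of_machine (Z := Bool × InfTree V) (fun z => z.2 []) next I hnext ?_ ?_
    (z := (false, f)) (Or.inr ⟨rfl, hf, h⟩)
  · rintro z hz
    rw [hout z hz, hout z hz]
    rcases hz with ⟨-, h1, -⟩ | ⟨-, h1, h2⟩
    · exact h1 []
    · exact h2.1 [] h1
  · intro zs d h0 hzs
    have hI : ∀ n, zs n ∈ I := by
      intro n
      induction n with
      | zero => exact h0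
      | succ n ih => rw [hzs]; exact hnext _ ih _
    have hiter : ∀ K b, (∀ n, (zs (n + K)).1 = b) →
        ∀ n, (zs (n + K)).2 [] = path (zs K).2 (fun i => d (i + K)) n := by
      intro K b hb n
      have := subtree_iterate (fs := fun n => (zs (n + K)).2) (d := fun i => d (i + K)) (by
        intro n
        have h1 := hzs (n + K)
        have h2 := hb n
        have h3 := hb (n + 1)
        rw [Nat.add_right_comm] at h3 ⊢
        rw [h1] at h3 ⊢
        simp only [next, h2] at h3 ⊢
        cases b
        · by_cases hk : (zs (n + K)).2 [d (n + K)] ∈ T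
          · simp [hk] at h3
          · simp [hk]
        · rfl) n []
      simpa [path] using this
    by_cases hK : ∃ K, (zs K).1 = true
    · obtain ⟨K, hK⟩ := hK
      have hb : ∀ n, (zs (n + K)).1 = true := by
        intro n
        induction n with
        | zero => simpa using hK
        | succ n ih => rw [Nat.add_right_comm, hzs]; simp [next, ih]
      rw [← parityGood_shift _ K]
      simp only [hiter K true hb]
      rcases hI K with ⟨-, -, h2⟩ | ⟨h2, -⟩
      · exact h2 _
      · rw [hK] at h2; exact absurd h2 (by decide)
    · have hb : ∀ n, (zs n).1 = false := fun n => by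
        by_contra h
        exact hK ⟨n, by simpa using h⟩
      have hit := hiter 0 false hb
      simp only [Nat.add_zero] at hit
      simp only [hit]
      have hf : ∀ n, zs n ∈ I ∧ (zs n).1 = false := fun n => ⟨hI n, hb n⟩
      have hT' : ∀ n, (zs n).2 [] ∉ T := fun n => by
        rcases hI n with ⟨h1, -⟩ | ⟨-, h1, -⟩
        · rw [hb n] at h1; exact absurd h1 (by decide)
        · exact h1
      rcases hI 0 with ⟨h1, -⟩ | ⟨-, -, h1⟩
      · rw [hb 0] at h1; exact absurd h1 (by decide)
      · rcases h1.2 d with ⟨k, hk⟩ | h1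
        · rw [← hit] at hk
          exact absurd hk (hT' k)
        · exact h1

/-- If every run can be prolonged to the set of the vertices of the greatest color, which is
even, and from there to another run of this kind, then the first player wins. -/
theorem runWins_of_runUntil {moves : V → Set (V × V)} {c : V → ℕ} {k : ℕ} (hk : Even k)
    (hc : ∀ v, c v ≤ k) {X : Set V}
    (hrun : ∀ v ∈ X, ∃ f : InfTree V, f [] = v ∧ (∀ u, f u ∈ X) ∧
      RunUntil moves c {v | c v = k} f)
    (hmove : ∀ v ∈ X, ∃ m ∈ moves v, m.1 ∈ X ∧ m.2 ∈ X) {v : V} (hv : v ∈ X) :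
    RunWins moves c v := by
  classical
  have : Nonempty (InfTree V) := ⟨fun _ => v⟩
  have : Nonempty (V × V) := ⟨(v, v)⟩
  choose! R hR0 hRX hR using hrun
  choose! mv hmv hmv1 hmv2 using hmove
  have hpick : ∀ v ∈ X, ∀ b, pick (mv v) b ∈ X := fun v hv b => by
    cases b
    · exact hmv1 v hv
    · exact hmv2 v hv
  -- A new run starts after each visit to the color `k`. Infinitely many such visits make the even
  -- greatest color recur; otherwise the branch finally stays in a single run, which is good on it.
  let next : InfTree V → Bool → InfTree V := fun f b =>
    if c (f []) = k then R (pick (mv (f [])) b) else TreeTopology.subtree f b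
  let I : Set (InfTree V) := {f | (∀ u, f u ∈ X) ∧ RunUntil moves c {v | c v = k} f}
  have hnext : ∀ f ∈ I, ∀ b, next f b ∈ I := by
    rintro f ⟨h1, h2⟩ b
    by_cases hf : c (f []) = k
    · simp only [next, hf, if_true]
      exact ⟨hRX _ (hpick _ (h1 []) b), hR _ (hpick _ (h1 []) b)⟩
    · simp only [next, hf, if_false]
      exact ⟨fun u => h1 (b :: u), h2.subtree hf b⟩
  have := runWins_of_machine (moves := moves) (c := c) (Z := InfTree V) (fun f => f []) next I
    hnext ?_ ?_ (z := R v) ⟨hRX v hv, hR v hv⟩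
  · rwa [hR0 v hv] at this
  · rintro f ⟨h1, h2⟩
    by_cases hf : c (f []) = k
    · simp only [next, hf, if_true]
      rw [hR0 _ (hpick _ (h1 []) _), hR0 _ (hpick _ (h1 []) _)]
      exact hmv _ (h1 [])
    · simp only [next, hf, if_false]
      exact h2.1 [] hf
  · intro fs d h0 hfs
    have hI : ∀ n, fs n ∈ I := by
      intro n
      induction n with
      | zero => exact h0
      | succ n ih => rw [hfs]; exact hnext _ ih _
    by_cases hfreq : ∃ᶠ n in atTop, c (fs n []) = k
    · exact ⟨k, hk, hfreq, Eventually.of_forall fun n => hc _⟩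
    · rw [not_frequently, eventually_atTop] at hfreq
      obtain ⟨K, hK⟩ := hfreq
      rw [← parityGood_shift _ K]
      have hit : ∀ n, fs (n + K) [] = path (fs K) (fun i => d (i + K)) n := by
        intro n
        have := subtree_iterate (fs := fun n => fs (n + K)) (d := fun i => d (i + K)) (by
          intro n
          show fs (n + 1 + K) = _
          rw [Nat.add_right_comm, hfs]
          exact if_neg (hK (n + K) (by omega))) n []
        simpa [path] using this
      rcases (hI K).2.2 fun i => d (i + K) with ⟨n, hn⟩ | h
      · rw [← hit] at hn
        exact absurd hn (hK _ (by omega))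
      · simpa only [hit] using h

/-- Positional strategies of the second player can be glued. -/
theorem exists_glued_positionalWins {S : Type*} [Nonempty S] (strat : S → V → V × V → Bool)
    (moves : V → Set (V × V)) (c : V → ℕ) :
    ∃ τ, ∀ v, (∃ i, PositionalWins moves c (strat i) v) → PositionalWins moves c τ v := by
  classical
  -- The strategies are well-ordered, and each vertex uses the least one that wins from it. This
  -- index never increases along a play, so a single strategy is followed from some point on.
  obtain ⟨_, hwf⟩ := exists_wellFoundedLT S
  have hmin : ∀ v, ∃ i, (∃ i, PositionalWins moves c (strat i) v) →
      PositionalWins moves c (strat i) v ∧ ∀ j, PositionalWins moves c (strat j) v → i ≤ j := by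
    intro v
    by_cases h : {i | PositionalWins moves c (strat i) v}.Nonempty
    · exact ⟨hwf.wf.min _ h, fun _ => ⟨hwf.wf.min_mem _ h, fun j hj =>
        not_lt.1 (hwf.wf.not_lt_min {i | PositionalWins moves c (strat i) v} hj)⟩⟩
    · exact ⟨Classical.arbitrary S, fun h' => absurd h' h⟩
  choose g hg using hmin
  refine ⟨fun v m => strat (g v) v m, fun v hv p h0 hp => ?_⟩
  have hW : ∀ n, ∃ i, PositionalWins moves c (strat i) (p n) := by
    intro n
    induction n with
    | zero => rwa [h0]
    | succ n ih =>
      obtain ⟨m, hm, h⟩ := hp n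
      exact ⟨g (p n), h ▸ (hg _ ih).1.step hm⟩
  have hle : ∀ n, g (p (n + 1)) ≤ g (p n) := fun n => by
    obtain ⟨m, hm, h⟩ := hp n
    exact (hg _ (hW (n + 1))).2 _ (h ▸ (hg _ (hW n)).1.step hm)
  have hanti : Antitone fun n => g (p n) := antitone_nat_of_succ_le hle
  have hne : (range fun n => g (p n)).Nonempty := range_nonempty _
  obtain ⟨N, hN⟩ := hwf.wf.min_mem _ hne
  have hconst : ∀ n, g (p (n + N)) = g (p N) := fun n =>
    le_antisymm (hanti (Nat.le_add_left N n)) (by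
      have := hwf.wf.not_lt_min (range fun n => g (p n)) (mem_range_self (n + N))
      rw [← hN] at this
      exact not_lt.1 this)
  rw [← parityGood_shift _ N]
  refine (hg _ (hW N)).1 _ (by simp) fun n => ?_
  obtain ⟨m, hm, h⟩ := hp (n + N)
  refine ⟨m, hm, ?_⟩
  simp only [hconst] at h
  rw [← h, Nat.add_right_comm]

theorem exists_uniform_positionalWins (moves : V → Set (V × V)) (c : V → ℕ) :
    ∃ τ, ∀ v, (∃ σ, PositionalWins moves c σ v) → PositionalWins moves c τ v :=
  exists_glued_positionalWins id moves c

/-- The vertices from which the second player has a positional winning strategy. -/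
def positionalRegion (moves : V → Set (V × V)) (c : V → ℕ) : Set V :=
  {v | ∃ τ, PositionalWins moves c τ v}

/-- To win it is enough for the second player to win the plays that stay outside of his
winning region. -/
theorem mem_positionalRegion {moves : V → Set (V × V)} {c : V → ℕ} {v : V}
    (τ : V → V × V → Bool)
    (h : ∀ p : ℕ → V, p 0 = v → IsPlay moves τ p → (∀ n, p n ∉ positionalRegion moves c) →
      ¬ ParityGood fun n => c (p n)) : v ∈ positionalRegion moves c := by
  classical
  obtain ⟨σ, hσ⟩ := exists_uniform_positionalWins moves c
  set W := positionalRegion moves c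
  -- Once the play enters `W`, the uniform strategy `σ` takes over and keeps it there.
  refine ⟨fun w m => if w ∈ W then σ w m else τ w m, fun p h0 hp => ?_⟩
  by_cases hW : ∃ N, p N ∈ W
  · obtain ⟨N, hN⟩ := hW
    have hmem : ∀ n, p (n + N) ∈ W := by
      intro n
      induction n with
      | zero => simpa using hN
      | succ n ih =>
        obtain ⟨m, hm, h⟩ := hp (n + N)
        rw [Nat.add_right_comm, h]
        simp only [ih, if_true]
        exact ⟨σ, (hσ _ ih).step hm⟩
    rw [← parityGood_shift _ N]
    refine hσ _ hN _ (by simp) fun n => ?_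
    obtain ⟨m, hm, h⟩ := hp (n + N)
    refine ⟨m, hm, ?_⟩
    simp only [hmem, if_true] at h
    rw [← h, Nat.add_right_comm]
  · push Not at hW
    refine h p h0 (fun n => ?_) hW
    obtain ⟨m, hm, h⟩ := hp n
    refine ⟨m, hm, ?_⟩
    simpa only [hW, if_false] using h

theorem exists_move_of_notMem_positionalRegion {moves : V → Set (V × V)} {c : V → ℕ} {v : V}
    (hv : v ∉ positionalRegion moves c) : ∃ m ∈ moves v, m.1 ∉ positionalRegion moves c ∧
      m.2 ∉ positionalRegion moves c := by
  classical
  by_contra! hm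
  -- If every available pair had a component in the region, the second player could enter it at
  -- once; `true` selects the second component.
  refine hv (mem_positionalRegion (fun _ m => decide (m.1 ∉ positionalRegion moves c)) ?_)
  intro p h0 hp hout
  exfalso
  obtain ⟨m, hm', h⟩ := hp 0
  rw [h0] at hm'
  have := hout 1
  rw [h] at this
  by_cases h1 : m.1 ∈ positionalRegion moves c
  · simp [pick, h1] at this
  · simp [pick, h1] at this
    exact this (hm m hm' h1)

/-- Induction on the greatest color. The vertices of this color and those of one player's winning
region are made terminal, which removes the color. Terminal means an empty set of moves when the
second player is to win there, and a loop of color `0` when the first player is. -/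
theorem positional_determinacy (k : ℕ) : ∀ (moves : V → Set (V × V)) (c : V → ℕ),
    (∀ v, c v ≤ k) → ∃ τ, ∀ v, RunWins moves c v ∨ PositionalWins moves c τ v := by
  classical
  have even_case : ∀ (moves : V → Set (V × V)) (c : V → ℕ) (k : ℕ), Even k → (∀ v, c v ≤ k) →
      (∀ v ∉ positionalRegion moves c, ∃ f : InfTree V, f [] = v ∧
        (∀ u, f u ∉ positionalRegion moves c) ∧ RunUntil moves c {v | c v = k} f) →
      ∃ τ, ∀ v, RunWins moves c v ∨ PositionalWins moves c τ v := by
    intro moves c k hk hc h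
    obtain ⟨τ, hτ⟩ := exists_uniform_positionalWins moves c
    refine ⟨τ, fun v => or_iff_not_imp_right.2 fun hv => ?_⟩
    exact runWins_of_runUntil (X := (positionalRegion moves c)ᶜ) hk hc h
      (fun v hv => exists_move_of_notMem_positionalRegion hv) fun h' => hv (hτ v h')
  induction k with
  | zero =>
    intro moves c hc
    refine even_case moves c 0 Even.zero hc fun v hv => ⟨fun _ => v, rfl, fun _ => hv, ?_⟩
    exact ⟨fun u hu => absurd (Nat.le_zero.1 (hc v)) hu,
      fun d => Or.inl ⟨0, Nat.le_zero.1 (hc v)⟩⟩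
  | succ k ih =>
    intro moves c hc
    rcases Nat.even_or_odd (k + 1) with hk | hk
    · refine even_case moves c (k + 1) hk hc fun v hv => ?_
      set W := positionalRegion moves c
      -- The greatest color is even: `W` becomes lost for the first player, and the remaining
      -- vertices of color `k + 1` become won.
      let moves' : V → Set (V × V) := fun w =>
        if w ∈ W then ∅ else if c w = k + 1 then {(w, w)} else moves w
      let c' : V → ℕ := fun w => if c w = k + 1 then 0 else c w
      obtain ⟨τ, hτ⟩ := ih moves' c' (fun w => by
        by_cases hw : c w = k + 1
        · simp [c', hw]
        · simp only [c', hw, if_false]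
          have := hc w
          omega)
      rcases hτ v with ⟨f, hf0, hf, hfd⟩ | hA
      · have hfW : ∀ u, f u ∉ W := fun u hu => by
          have := hf u
          simp [moves', hu] at this
        refine ⟨f, hf0, hfW, fun u hu => ?_, fun d => ?_⟩
        · have hu : c (f u) ≠ k + 1 := hu
          have := hf u
          simpa only [moves', hfW, hu, if_false] using this
        · refine or_iff_not_imp_left.2 fun hd => ?_
          push Not at hd
          have := hfd d
          have hd' : ∀ n, c (path f d n) ≠ k + 1 := hd
          simpa only [c', hd', if_false] using this
      · refine absurd (mem_positionalRegion τ fun p h0 hp hout => ?_) hv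
        by_cases hN : ∃ N, c (p N) = k + 1
        · exfalso
          have hmin : ∀ n < Nat.find hN, c (p n) ≠ k + 1 := fun n hn => Nat.find_min hN hn
          have hspec := Nat.find_spec hN
          set N := Nat.find hN
          -- Stopped at its first visit to color `k + 1`, the play is a play of the modified game
          -- that loops in color `0`, which `τ` does not allow.
          have hz : ParityGood fun n => c' (p (min n N)) := by
            rw [← parityGood_shift _ N]
            have : ∀ n, c' (p (min (n + N) N)) = 0 := fun n => by
              rw [min_eq_right (by omega)]
              simp [c', hspec]
            simp only [this]
            exact parityGood_const Even.zero
          refine hA (fun n => p (min n N)) (by simpa using h0) (fun n => ?_) hz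
          beta_reduce
          rcases lt_or_ge n N with hn | hn
          · obtain ⟨m, hm, h⟩ := hp n
            rw [min_eq_left hn.le, min_eq_left hn]
            refine ⟨m, ?_, h⟩
            simpa only [moves', show p n ∉ W from hout n, hmin n hn, if_false] using hm
          · rw [min_eq_right hn, min_eq_right (by omega)]
            refine ⟨(p N, p N), ?_, ?_⟩
            · simp only [moves', show p N ∉ W from hout N, hspec, if_false, if_true]
              rfl
            · unfold pick
              split_ifs <;> rfl
        · push Not at hN
          have := hA p h0 fun n => by
            obtain ⟨m, hm, h⟩ := hp n
            refine ⟨m, ?_, h⟩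
            simpa only [moves', show p n ∉ W from hout n, hN, if_false] using hm
          simpa only [c', hN, if_false] using this
    · set T := {v | RunWins moves c v} with hT
      -- The greatest color is odd: `T` becomes won for the first player, and the vertices of color
      -- `k + 1` outside of `T` become lost.
      let moves' : V → Set (V × V) := fun w =>
        if w ∈ T then {(w, w)} else if c w = k + 1 then ∅ else moves w
      let c' : V → ℕ := fun w => if w ∈ T ∨ c w = k + 1 then 0 else c w
      obtain ⟨τ, hτ⟩ := ih moves' c' (fun w => by
        by_cases hw : w ∈ T ∨ c w = k + 1
        · simp [c', hw]
        · simp only [c', hw, if_false]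
          have := hc w
          have : c w ≠ k + 1 := fun h => hw (Or.inr h)
          omega)
      -- A run that wins the modified game is a run of the original game until `T`, so it starts in
      -- `T`; conversely `τ` cannot beat the loops at the vertices of `T`.
      have hTτ : ∀ v, PositionalWins moves' c' τ v ↔ v ∉ T := by
        intro v
        constructor
        · intro h hv
          refine h (fun _ => v) rfl (fun n => ⟨(v, v), ?_, ?_⟩) ?_
          · simp only [moves', hv, if_true]
            rfl
          · unfold pick
            split_ifs <;> rfl
          · simp only [c', hv, true_or, if_true]
            exact parityGood_const Even.zero
        · intro hv
          refine (hτ v).resolve_left ?_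
          rintro ⟨f, rfl, hf, hfd⟩
          refine hv (RunUntil.runWins ⟨fun u hu => ?_, fun d => ?_⟩)
          · have hu : f u ∉ T := hu
            have := hf u
            by_cases hcu : c (f u) = k + 1
            · simp only [moves', hu, hcu, if_false, if_true] at this
              exact absurd this (notMem_empty _)
            · simpa only [moves', hu, hcu, if_false] using this
          · refine or_iff_not_imp_left.2 fun hd => ?_
            push Not at hd
            have hd : ∀ n, path f d n ∉ T := hd
            have hd' : ∀ n, c (path f d n) ≠ k + 1 := fun n hn => by
              have := hf (branchNode d n)
              have h1 : f (branchNode d n) ∉ T := hd n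
              have h2 : c (f (branchNode d n)) = k + 1 := hn
              simp only [moves', h1, h2, if_false, if_true] at this
              exact absurd this (notMem_empty _)
            have := hfd d
            simpa only [c', hd, hd', or_self, if_false] using this
      -- At a vertex of color `k + 1` outside of `T` every pair has a component outside of `T`, and
      -- `σ` moves to it.
      let σ : V → V × V → Bool := fun w m =>
        if c w = k + 1 then decide (m.1 ∈ T) else τ w m
      refine ⟨σ, fun v => or_iff_not_imp_left.2 fun hv p h0 hp hgood => ?_⟩
      have hout : ∀ n, p n ∉ T := by
        intro n
        induction n with
        | zero => rwa [h0]
        | succ n ih =>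
          obtain ⟨m, hm, h⟩ := hp n
          by_cases hcn : c (p n) = k + 1
          · intro hmem
            simp only [σ, hcn, if_true] at h
            by_cases h1 : m.1 ∈ T
            · have : p (n + 1) = m.2 := by simpa [pick, h1] using h
              rw [this] at hmem
              exact ih (runWins_of_move hm h1 hmem)
            · have : p (n + 1) = m.1 := by simpa [pick, h1] using h
              rw [this] at hmem
              exact h1 hmem
          · have hm' : m ∈ moves' (p n) := by simpa only [moves', ih, hcn, if_false] using hm
            simp only [σ, hcn, if_false] at h
            rw [h]
            exact (hTτ _).1 (((hTτ _).2 ih).step hm')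
      -- Either the odd greatest color recurs, or a tail of the play is a play of the modified game,
      -- which `τ` wins.
      by_cases hfreq : ∃ᶠ n in atTop, c (p n) = k + 1
      · obtain ⟨j, hj, hj1, hj2⟩ := hgood
        obtain ⟨n, hn1, hn2⟩ := (hfreq.and_eventually hj2).exists
        obtain ⟨n', hn'⟩ := hj1.exists
        have h1 := hc (p n')
        simp only at hn2 hn'
        have : j = k + 1 := by omega
        subst this
        exact (Nat.not_even_iff_odd.2 hk) hj
      · rw [not_frequently, eventually_atTop] at hfreq
        obtain ⟨K, hK⟩ := hfreq
        have hK' : ∀ n, c (p (n + K)) ≠ k + 1 := fun n => hK _ (by omega)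
        refine (hTτ _).2 (hout K) (fun n => p (n + K)) (by simp) (fun n => ?_) ?_
        · obtain ⟨m, hm, h⟩ := hp (n + K)
          refine ⟨m, ?_, ?_⟩
          · simpa only [moves', hout, hK', if_false] using hm
          · simp only [σ, hK', if_false] at h
            rw [← h, Nat.add_right_comm]
        · simp only [c', hout, hK', or_self, if_false]
          exact (parityGood_shift (fun n => c (p n)) K).2 hgood

end Parity

/-! ### Visit records turn the Muller condition into a parity condition. -/

section Record

variable {Q : Type*}

/-- The record that keeps for each state the set of the states visited since its last visit,
after a visit of `q`. -/
def updateRecord (R : Q → Set Q) (q : Q) : Q → Set Q :=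
  fun x => {y | y = q ∨ (x ≠ q ∧ y ∈ R x)}

/-- The record before the `n`-th letter of a word. -/
def recordAt (p : ℕ → Q) : ℕ → Q → Set Q
  | 0 => fun _ => ∅
  | n + 1 => updateRecord (recordAt p n) (p n)

theorem mem_recordAt {p : ℕ → Q} {n : ℕ} {q x : Q} :
    x ∈ recordAt p n q ↔ ∃ i < n, p i = x ∧ ∀ j, i < j → j < n → p j ≠ q := by
  induction n with
  | zero => simp [recordAt]
  | succ n ih =>
    have : x ∈ recordAt p (n + 1) q ↔ x = p n ∨ (q ≠ p n ∧ x ∈ recordAt p n q) := Iff.rfl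
    rw [this, ih]
    constructor
    · rintro (rfl | ⟨hq, i, hi, hx, h⟩)
      · exact ⟨n, Nat.lt_succ_self n, rfl, fun j h1 h2 => by omega⟩
      · refine ⟨i, by omega, hx, fun j h1 h2 => ?_⟩
        rcases Nat.lt_succ_iff_lt_or_eq.1 h2 with h2 | rfl
        · exact h j h1 h2
        · exact hq.symm
    · rintro ⟨i, hi, hx, h⟩
      rcases Nat.lt_succ_iff_lt_or_eq.1 hi with hi | rfl
      · exact Or.inr ⟨(h n hi (Nat.lt_succ_self n)).symm, i, hi, hx,
          fun j h1 h2 => h j h1 (by omega)⟩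
      · exact Or.inl hx.symm

theorem self_mem_recordAt {p : ℕ → Q} {i n : ℕ} (hi : i < n) : p i ∈ recordAt p n (p i) := by
  classical
  induction n with
  | zero => omega
  | succ n ih =>
    by_cases h : p i = p n
    · exact Or.inl h
    · have : i ≠ n := fun h' => h (by rw [h'])
      exact Or.inr ⟨h, ih (by omega)⟩

variable [Finite Q]

theorem exists_window (p : ℕ → Q) (N : ℕ) :
    ∃ n, N ≤ n ∧ ∀ q ∈ infOften p, ∃ i, N ≤ i ∧ i < n ∧ p i = q := by
  have : ∀ q : Q, ∀ᶠ n in atTop, q ∈ infOften p → ∃ i, N ≤ i ∧ i < n ∧ p i = q := by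
    intro q
    by_cases hq : q ∈ infOften p
    · obtain ⟨i, hi, h⟩ := frequently_atTop.1 hq N
      filter_upwards [eventually_gt_atTop i] with n hn _
      exact ⟨i, hi, hn, h⟩
    · exact Eventually.of_forall fun n h => absurd h hq
  obtain ⟨n, hn, h⟩ := ((eventually_ge_atTop N).and (eventually_all.2 this)).exists
  exact ⟨n, hn, h⟩

/-- From some time on only recurring states are visited; after one more visit to each of them, the
last visit to the current state is later than this time. -/
theorem eventually_recordAt_subset (p : ℕ → Q) :
    ∀ᶠ n in atTop, recordAt p n (p n) ⊆ infOften p := by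
  obtain ⟨m, hm⟩ := eventually_atTop.1 (eventually_mem_infOften p)
  obtain ⟨n₀, hn₀, h⟩ := exists_window p m
  filter_upwards [eventually_ge_atTop n₀] with n hn x hx
  obtain ⟨i, hi, rfl, hlast⟩ := mem_recordAt.1 hx
  obtain ⟨i', h1, h2, h3⟩ := h (p n) (hm n (by omega))
  refine hm i ?_
  by_contra hlt
  exact hlast i' (by omega) (by omega) h3

theorem frequently_subset_recordAt (p : ℕ → Q) :
    ∃ᶠ n in atTop, infOften p ⊆ recordAt p n (p n) := by
  classical
  rw [frequently_atTop]
  intro N₀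
  obtain ⟨N, hN, hwin⟩ := exists_window p N₀
  have hex : ∀ q ∈ infOften p, ∃ i, N ≤ i ∧ p i = q := fun q hq => by
    obtain ⟨i, hi, h⟩ := frequently_atTop.1 hq N
    exact ⟨i, hi, h⟩
  let first : Q → ℕ := fun q => if h : ∃ i, N ≤ i ∧ p i = q then Nat.find h else 0
  have hfirst : ∀ q ∈ infOften p, N ≤ first q ∧ p (first q) = q ∧
      ∀ j, N ≤ j → j < first q → p j ≠ q := by
    intro q hq
    have h := hex q hq
    have hf : first q = Nat.find h := dif_pos h
    rw [hf]
    exact ⟨(Nat.find_spec h).1, (Nat.find_spec h).2, fun j h1 h2 h3 =>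
      Nat.find_min h h2 ⟨h1, h3⟩⟩
  -- At the first visit from `N` on to the state `q` that reappears last, all other recurring states
  -- have been seen since the previous visit to `q`.
  obtain ⟨q, hq, hmax⟩ := (toFinite (infOften p)).exists_maximalFor first _ (infOften_nonempty p)
  obtain ⟨h1, h2, h3⟩ := hfirst q hq
  refine ⟨first q, by omega, fun x hx => ?_⟩
  rw [h2]
  by_cases hxq : x = q
  · subst hxq
    obtain ⟨i, -, hi, rfl⟩ := hwin x hx
    exact self_mem_recordAt (by omega)
  · obtain ⟨g1, g2, g3⟩ := hfirst x hx
    have hne : first x ≠ first q := fun h => hxq (by rw [← g2, h, h2])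
    have hle : first x ≤ first q := by
      rcases le_total (first q) (first x) with h | h
      · exact hmax hx h
      · exact h
    exact mem_recordAt.2 ⟨first x, by omega, g2, fun j hj1 hj2 => h3 j (by omega) hj2⟩

open Classical in
/-- The color of the visit of `q` with the record `R`. -/
noncomputable def recordColor (𝓕 : Set (Set Q)) (q : Q) (R : Q → Set Q) : ℕ :=
  2 * (R q).ncard + if R q ∈ 𝓕 then 0 else 1

theorem recordColor_le (𝓕 : Set (Set Q)) (q : Q) (R : Q → Set Q) :
    recordColor 𝓕 q R ≤ 2 * Nat.card Q + 1 := by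
  have : (R q).ncard ≤ Nat.card Q := by
    rw [← ncard_univ]
    exact ncard_le_ncard (subset_univ _)
  unfold recordColor
  split_ifs <;> omega

/-- The record of the current state equals the set of recurring states infinitely often and is
eventually never larger. The greatest recurring color therefore comes from this set, and its parity
tells whether the set is in `𝓕`. -/
theorem parityGood_recordColor (𝓕 : Set (Set Q)) (p : ℕ → Q) :
    (ParityGood fun n => recordColor 𝓕 (p n) (recordAt p n)) ↔ infOften p ∈ 𝓕 := by
  classical
  set I := infOften p with hI
  have hfreq : ∃ᶠ n in atTop, recordAt p n (p n) = I :=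
    ((frequently_subset_recordAt p).and_eventually (eventually_recordAt_subset p)).mono
      fun n hn => Subset.antisymm hn.2 hn.1
  have hlt : ∀ᶠ n in atTop, recordAt p n (p n) = I ∨ (recordAt p n (p n)).ncard < I.ncard :=
    (eventually_recordAt_subset p).mono fun n hn => by
      rcases hn.eq_or_ssubset with h | h
      · exact Or.inl h
      · exact Or.inr (ncard_lt_ncard h)
  by_cases hF : I ∈ 𝓕
  · refine iff_of_true ⟨2 * I.ncard, even_two_mul _, hfreq.mono fun n hn => ?_,
      hlt.mono fun n hn => ?_⟩ hF
    · simp [recordColor, hn, hF]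
    · rcases hn with hn | hn
      · simp [recordColor, hn, hF]
      · unfold recordColor
        beta_reduce
        split_ifs <;> omega
  · refine iff_of_false ?_ hF
    rintro ⟨k, hk, h1, h2⟩
    obtain ⟨n, hn, hn'⟩ := (hfreq.and_eventually h2).exists
    obtain ⟨m, hm, hm'⟩ := (h1.and_eventually hlt).exists
    simp only [recordColor, hn, hF, if_false] at hn'
    have hk' : k ≤ 2 * I.ncard + 1 := by
      rw [← hm]
      rcases hm' with hm' | hm'
      · simp [recordColor, hm', hF]
      · unfold recordColor
        beta_reduce
        split_ifs <;> omega
    have : k = 2 * I.ncard + 1 := by omega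
    subst this
    exact (Nat.not_even_iff_odd.2 (odd_two_mul_add_one _)) hk

end Record

/-! ### Deterministic Muller automata on infinite words. -/

section Words

theorem exists_frequently {ι : Type*} [Finite ι] {φ : ι → ℕ → Prop}
    (h : ∃ᶠ n in atTop, ∃ i, φ i n) : ∃ i, ∃ᶠ n in atTop, φ i n := by
  by_contra! hc
  refine h ?_
  filter_upwards [eventually_all.2 fun i => hc i] with n hn ⟨i, hi⟩
  exact hn i hi

variable {B : Type*}

/-- The state of a deterministic automaton after a prefix of a word. -/
def detRun {D : Type*} (d₀ : D) (δ : D → B → D) (w : ℕ → B) : ℕ → D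
  | 0 => d₀
  | n + 1 => δ (detRun d₀ δ w n) (w n)

/-- Sets of infinite words accepted by deterministic Muller automata whose acceptance condition
refers to the pairs of a state and the letter read in it. -/
def IsDetMuller (P : (ℕ → B) → Prop) : Prop :=
  ∃ (D : Type) (_ : Finite D) (d₀ : D) (δ : D → B → D) (𝓕 : Set (Set (D × B))),
    ∀ w, P w ↔ infOften (fun n => (detRun d₀ δ w n, w n)) ∈ 𝓕

end Words

/-! ### Ramsey-type factorizations of infinite words. -/

section Factor

variable {B S : Type*} (one : S) (ext : S → B → S) (w : ℕ → B)

/-- The value of the factor of `w` between the positions `i` and `k`. -/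
def factor (i : ℕ) : ℕ → S
  | 0 => one
  | k + 1 => if i ≤ k then ext (factor i k) (w k) else one

theorem factor_of_le {i k : ℕ} (h : k ≤ i) : factor one ext w i k = one := by
  cases k with
  | zero => rfl
  | succ k => exact if_neg (by omega)

theorem factor_succ {i k : ℕ} (h : i ≤ k) :
    factor one ext w i (k + 1) = ext (factor one ext w i k) (w k) := if_pos h

theorem factor_merged {i j k l : ℕ} (hi : i ≤ k) (hj : j ≤ k) (hkl : k ≤ l)
    (h : factor one ext w i k = factor one ext w j k) :
    factor one ext w i l = factor one ext w j l := by
  induction l, hkl using Nat.le_induction with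
  | base => exact h
  | succ l hl ih => rw [factor_succ _ _ _ (hi.trans hl), factor_succ _ _ _ (hj.trans hl), ih]

/-- The position `i` is reached from `r` with the value `e`, and `r` and `i` are merged later. -/
def Merges (r : ℕ) (e : S) (i : ℕ) : Prop :=
  r ≤ i ∧ factor one ext w r i = e ∧ ∃ k ≥ i, factor one ext w r k = factor one ext w i k

/-- The word `w` has infinitely many positions that are reached from `r` with the value `e`
and are merged with `r`, where `r` is reached with the value `s`. -/
def Linked (s e : S) : Prop :=
  ∃ r, factor one ext w 0 r = s ∧ ∃ᶠ i in atTop, Merges one ext w r e i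

/-- Along a nonprincipal ultrafilter each `factor one ext w i k` has a limit value in `k`, and these
limits have a limit `e` in `i`. For `r` with limit value `e`, almost every `i` has the same limit
value, hence merges with `r`, and is reached from `r` with the value `e`. -/
theorem exists_linked [Finite S] : ∃ s e, Linked one ext w s e := by
  let 𝒰 : Ultrafilter ℕ := hyperfilter ℕ
  have hle : (𝒰 : Filter ℕ) ≤ atTop := by
    rw [← Nat.cofinite_eq_atTop]; exact hyperfilter_le_cofinite
  have hex : ∀ f : ℕ → S, ∃ s, ∀ᶠ k in (𝒰 : Filter ℕ), f k = s := by
    intro f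
    obtain ⟨s, hs⟩ := (Ultrafilter.eventually_exists_iff (f := 𝒰) (P := fun s k => f k = s)).1
      (Eventually.of_forall fun k => ⟨f k, rfl⟩)
    exact ⟨s, hs⟩
  choose v hv using fun i => hex (factor one ext w i)
  obtain ⟨e, he⟩ := hex v
  obtain ⟨r, hr⟩ := he.exists
  refine ⟨_, e, r, rfl, ?_⟩
  have h1 : ∀ᶠ i in (𝒰 : Filter ℕ), Merges one ext w r e i := by
    filter_upwards [he, hr ▸ hv r, hle (eventually_ge_atTop r)] with i hi hri hle'
    refine ⟨hle', hri, ?_⟩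
    obtain ⟨k, ⟨hk1, hk2⟩, hk3⟩ := (((hr ▸ hv r).and (hi ▸ hv i)).and
      (hle (eventually_ge_atTop i))).exists
    exact ⟨k, hk3, hk1.trans hk2.symm⟩
  exact h1.frequently.filter_mono hle

/-- A factorization into a factor of value `s` and infinitely many factors of value `e`. -/
theorem Linked.exists_factorization {one : S} {ext : S → B → S} {w : ℕ → B} {s e : S}
    (h : Linked one ext w s e) : ∃ β : ℕ → ℕ, StrictMono β ∧ factor one ext w 0 (β 0) = s ∧
      ∀ n, factor one ext w (β n) (β (n + 1)) = e := by
  obtain ⟨r, hr, hfreq⟩ := h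
  let J := {j : ℕ // r ≤ j ∧ ∃ k ≥ j, factor one ext w r k = factor one ext w j k}
  have hnext : ∀ j : J, ∃ j' : J, j.1 < j'.1 ∧ factor one ext w j.1 j'.1 = e := by
    rintro ⟨j, hrj, k, hk, hjk⟩
    -- Beyond the merging point `k` the factors from `j` and from `r` have equal values, so the
    -- factor from `j` to `i` has the value `e`.
    obtain ⟨i, hi, h1, h2, h3⟩ := frequently_atTop.1 hfreq (max k (j + 1))
    refine ⟨⟨i, h1, h3⟩, show j < i by omega, ?_⟩
    rw [← h2]
    exact (factor_merged one ext w (hrj.trans hk) hk ((le_max_left _ _).trans hi) hjk).symm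
  choose next hnext using hnext
  let β : ℕ → J := fun n => Nat.rec ⟨r, le_rfl, r, le_rfl, rfl⟩ (fun _ j => next j) n
  exact ⟨fun n => (β n).1, strictMono_nat_of_lt_succ fun n => (hnext (β n)).1, hr,
    fun n => (hnext (β n)).2⟩

end Factor

/-! ### Following infinitely many finite-state threads with a finite memory. -/

section Threads

variable {B C : Type*} (start : ℕ → C) (step : C → B → C) (w : ℕ → B)

/-- The state at time `k` of the thread started at time `r`. -/
def thread (r : ℕ) : ℕ → C
  | 0 => start r
  | k + 1 => if r ≤ k then step (thread r k) (w k) else start r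

theorem thread_of_le {r k : ℕ} (h : k ≤ r) : thread start step w r k = start r := by
  cases k with
  | zero => rfl
  | succ k => exact if_neg (by omega)

theorem thread_succ {r k : ℕ} (h : r ≤ k) :
    thread start step w r (k + 1) = step (thread start step w r k) (w k) := if_pos h

/-- The states at time `k` of the threads older than `r`. -/
def olderThreads (r k : ℕ) : Set C := (fun r' => thread start step w r' k) '' {r' | r' < r}

theorem olderThreads_succ {r k : ℕ} (h : r ≤ k + 1) :
    olderThreads start step w r (k + 1) = (step · (w k)) '' olderThreads start step w r k := by
  unfold olderThreads
  rw [image_image]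
  refine image_congr fun r' hr' => ?_
  have hr' : r' < r := hr'
  exact thread_succ _ _ _ (by omega)

/-- All threads at time `k`, each with the states of the older ones. -/
def threadsAt (k : ℕ) : Set (C × Set C) :=
  (fun r => (thread start step w r k, olderThreads start step w r k)) '' {r | r ≤ k}

/-- The successor of `M` under the letter `b`, with a new thread that starts in `c`. -/
def nextThreads {B C : Type*} (step : C → B → C) (M : Set (C × Set C)) (b : B) (c : C) :
    Set (C × Set C) :=
  insert (c, (fun x => step x.1 b) '' M) ((fun x => (step x.1 b, (step · b) '' x.2)) '' M)

theorem threadsAt_zero : threadsAt start step w 0 = {(start 0, ∅)} := by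
  have : {r : ℕ | r ≤ 0} = {0} := by ext; simp
  rw [threadsAt, this, image_singleton]
  simp [olderThreads, thread]

theorem threadsAt_succ (k : ℕ) : threadsAt start step w (k + 1) =
    nextThreads step (threadsAt start step w k) (w k) (start (k + 1)) := by
  have : {r : ℕ | r ≤ k + 1} = insert (k + 1) {r | r ≤ k} := by ext; simp; try omega
  rw [threadsAt, this, image_insert_eq, nextThreads, threadsAt, image_image, image_image]
  congr 1
  · rw [thread_of_le _ _ _ le_rfl, olderThreads]
    congr 1
    have : {r' : ℕ | r' < k + 1} = {r | r ≤ k} := by ext; simp; try omega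
    rw [this]
    exact image_congr fun r hr => thread_succ _ _ _ hr
  · refine image_congr fun r hr => ?_
    have hr : r ≤ k := hr
    rw [thread_succ _ _ _ hr, olderThreads_succ _ _ _ (by omega)]

/-- The thread of rank `p` exists, and remains the thread of rank `p` under the letter `b`. -/
def StableRank {B C : Type*} (step : C → B → C) (p : ℕ) (M : Set (C × Set C)) (b : B) : Prop :=
  ∃ x ∈ M, x.1 ∉ x.2 ∧ x.2.ncard = p ∧ step x.1 b ∉ (step · b) '' x.2 ∧
    ((step · b) '' x.2).ncard = p

/-- A thread is alive while no older thread shares its state, and its rank is the number of states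
of the older ones. The oldest thread that meets `F` infinitely often stays alive, since an older one
merged with it would meet `F` infinitely often too. Conversely, the rank identifies a living thread,
so an eventually stable rank follows a single one. -/
theorem exists_thread_iff [Finite C] (F : Set C) :
    (∃ r, ∃ᶠ k in atTop, r ≤ k ∧ thread start step w r k ∈ F) ↔
      ∃ p, (∀ᶠ k in atTop, StableRank step p (threadsAt start step w k) (w k)) ∧
        ∃ᶠ k in atTop, ∃ x ∈ threadsAt start step w k, x.1 ∉ x.2 ∧ x.2.ncard = p ∧ x.1 ∈ F := by
  classical
  set X := thread start step w with hX
  set O := olderThreads start step w with hO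
  constructor
  · intro h
    set r := Nat.find h with hr
    have hfreq := Nat.find_spec h
    have hmin : ∀ r' < r, ¬ ∃ᶠ k in atTop, r' ≤ k ∧ X r' k ∈ F := fun r' h' => Nat.find_min h h'
    have halive : ∀ k, r ≤ k → X r k ∉ O r k := by
      rintro k hk ⟨r', hr', heq⟩
      have hr' : r' < r := hr'
      have heq : X r' k = X r k := heq
      have : ∀ l, k ≤ l → X r' l = X r l := by
        intro l hl
        induction l, hl using Nat.le_induction with
        | base => exact heq
        | succ l hl ih =>
          rw [hX, thread_succ _ _ _ (by omega), thread_succ _ _ _ (by omega), ← hX, ih]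
      refine hmin r' hr' ?_
      refine (hfreq.and_eventually (eventually_ge_atTop k)).mono fun l hl => ⟨by omega, ?_⟩
      rw [this l hl.2]
      exact hl.1.2
    have hsucc : ∀ k, r ≤ k → O r (k + 1) = (step · (w k)) '' O r k := fun k hk =>
      olderThreads_succ _ _ _ (by omega)
    -- The older threads move by a function on states, so the number of their states cannot grow and
    -- is finally constant.
    have hanti : Antitone fun n => (O r (n + r)).ncard := antitone_nat_of_succ_le fun n => by
      rw [Nat.add_right_comm, hsucc _ (by omega)]
      exact ncard_image_le (toFinite _)
    obtain ⟨N, hN⟩ : ∃ N, ∀ n ≥ N, (O r (n + r)).ncard = (O r (N + r)).ncard := by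
      obtain ⟨N, hN⟩ := (wellFounded_lt (α := ℕ)).has_min
        (range fun n => (O r (n + r)).ncard) (range_nonempty _)
      obtain ⟨⟨N, rfl⟩, hmin'⟩ := hN
      exact ⟨N, fun n hn => le_antisymm (hanti hn) (not_lt.1 (hmin' _ (mem_range_self n)))⟩
    have hcard : ∀ k, N + r ≤ k → (O r k).ncard = (O r (N + r)).ncard := fun k hk => by
      rw [← hN (k - r) (by omega), Nat.sub_add_cancel (by omega)]
    have hmem : ∀ k, r ≤ k → (X r k, O r k) ∈ threadsAt start step w k := fun k hk =>
      mem_image_of_mem _ hk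
    refine ⟨(O r (N + r)).ncard, ?_, ?_⟩
    · filter_upwards [eventually_ge_atTop (N + r)] with k hk
      refine ⟨_, hmem k (by omega), halive k (by omega), hcard k hk, ?_, ?_⟩
      · rw [← hsucc k (by omega)]
        have := halive (k + 1) (by omega)
        rwa [hX, thread_succ _ _ _ (by omega)] at this
      · rw [← hsucc k (by omega)]
        exact hcard _ (by omega)
    · refine (hfreq.and_eventually (eventually_ge_atTop (N + r))).mono fun k hk => ?_
      exact ⟨_, hmem k (by omega), halive k (by omega), hcard k hk.2, hk.1.2⟩
  · rintro ⟨p, hstable, hfreq⟩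
    obtain ⟨K, hK⟩ := eventually_atTop.1 hstable
    have huniq : ∀ k r₁ r₂, r₁ ≤ k → r₂ ≤ k → X r₁ k ∉ O r₁ k → X r₂ k ∉ O r₂ k →
        (O r₁ k).ncard = p → (O r₂ k).ncard = p → r₁ = r₂ := by
      have : ∀ k r₁ r₂, r₁ < r₂ → X r₁ k ∉ O r₁ k → (O r₁ k).ncard = p →
          (O r₂ k).ncard = p → False := by
        intro k r₁ r₂ hlt h1 h2 h3
        have hss : O r₁ k ⊂ O r₂ k := by
          refine ssubset_of_subset_not_subset (image_mono fun r hr => lt_trans hr hlt) fun hsub => ?_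
          exact h1 (hsub (mem_image_of_mem _ hlt))
        have := ncard_lt_ncard hss
        omega
      intro k r₁ r₂ _ _ h1 h2 h3 h4
      rcases lt_trichotomy r₁ r₂ with h | h | h
      · exact (this k _ _ h h1 h3 h4).elim
      · exact h
      · exact (this k _ _ h h2 h4 h3).elim
    obtain ⟨_, ⟨r, hr, rfl⟩, hr1, hr2, -, -⟩ := hK K le_rfl
    have hr : r ≤ K := hr
    have hinv : ∀ k, K ≤ k → X r k ∉ O r k ∧ (O r k).ncard = p := by
      intro k hk
      induction k, hk using Nat.le_induction with
      | base => exact ⟨hr1, hr2⟩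
      | succ k hk ih =>
        obtain ⟨_, ⟨r', hr', rfl⟩, h1, h2, h3, h4⟩ := hK k hk
        have hr' : r' ≤ k := hr'
        obtain rfl := huniq k r' r hr' (by omega) h1 ih.1 h2 ih.2
        simp only at h3 h4
        rw [← olderThreads_succ _ _ _ (by omega), ← thread_succ start step w (by omega)] at h3
        rw [← olderThreads_succ _ _ _ (by omega)] at h4
        exact ⟨h3, h4⟩
    refine ⟨r, (hfreq.and_eventually (eventually_ge_atTop K)).mono ?_⟩
    rintro k ⟨⟨_, ⟨r', hr', rfl⟩, h1, h2, h3⟩, hk⟩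
    have hr' : r' ≤ k := hr'
    obtain ⟨h4, h5⟩ := hinv k hk
    obtain rfl := huniq k r' r hr' (by omega) h1 h4 h2 h5
    exact ⟨by omega, h3⟩

end Threads

/-! ### Deterministic detection of linked pairs. -/

section Determinization

variable {B : Type*} {S : Type*} (one : S) (ext : S → B → S) (Good : S → S → Prop)

/-- A thread keeps the value with which its start was reached, the value of the factor read
since its start, and the values of the candidate positions. -/
abbrev Detector (S : Type*) : Type _ := S × S × Set (S × S)

/-- A thread signals when it is merged with a candidate position of good value. -/
def Signals (x : Detector S) : Prop := ∃ e, Good x.1 e ∧ (e, x.2.1) ∈ x.2.2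

/-- One step of a thread. -/
def detectorStep (x : Detector S) (b : B) : Detector S :=
  (x.1, ext x.2.1 b, {y | y = (ext x.2.1 b, one) ∨
    (¬ Signals Good x ∧ ∃ z, (y.1, z) ∈ x.2.2 ∧ y.2 = ext z b)})

/-- The initial state of a thread. -/
def detectorStart (s : S) : Detector S := (s, one, {(one, one)})

variable (w : ℕ → B)

/-- The state of the detector started at time `r`. -/
def detector (r k : ℕ) : Detector S :=
  thread (fun r => detectorStart one (factor one ext w 0 r)) (detectorStep one ext Good) w r k

theorem detector_self (r : ℕ) :
    detector one ext Good w r r = detectorStart one (factor one ext w 0 r) :=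
  thread_of_le _ _ _ le_rfl

theorem detector_succ {r k : ℕ} (h : r ≤ k) :
    detector one ext Good w r (k + 1) =
      detectorStep one ext Good (detector one ext Good w r k) (w k) :=
  thread_succ _ _ _ h

theorem detector_values {r k : ℕ} (h : r ≤ k) :
    (detector one ext Good w r k).1 = factor one ext w 0 r ∧
      (detector one ext Good w r k).2.1 = factor one ext w r k := by
  induction k, h using Nat.le_induction with
  | base => rw [detector_self, factor_of_le one ext w le_rfl (i := r)]; exact ⟨rfl, rfl⟩
  | succ k hk ih =>
    rw [detector_succ _ _ _ _ hk, factor_succ _ _ _ hk, ← ih.2, ← ih.1]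
    exact ⟨rfl, rfl⟩

/-- A signal discards the old candidates, so later candidates lie beyond it. Thus infinitely many
signals come from infinitely many merging positions. -/
theorem detector_sound {r k₀ k : ℕ} (h₀ : r ≤ k₀) (hs : Signals Good (detector one ext Good w r k₀))
    (hk : k₀ < k) {e y : S} (h : (e, y) ∈ (detector one ext Good w r k).2.2) :
    ∃ i, k₀ < i ∧ i ≤ k ∧ factor one ext w r i = e ∧ factor one ext w i k = y := by
  induction k, (show k₀ + 1 ≤ k from hk) using Nat.le_induction generalizing y with
  | base =>
    rw [detector_succ _ _ _ _ h₀] at h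
    rcases h with h | ⟨hn, -⟩
    · rw [Prod.mk.injEq] at h
      refine ⟨k₀ + 1, by omega, le_rfl, ?_, ?_⟩
      · rw [h.1, (detector_values one ext Good w h₀).2, factor_succ _ _ _ h₀]
      · rw [h.2, factor_of_le one ext w le_rfl]
    · exact absurd hs hn
  | succ k hk' ih =>
    have hrk : r ≤ k := by omega
    rw [detector_succ _ _ _ _ hrk] at h
    rcases h with h | ⟨-, z, hz, hy⟩
    · rw [Prod.mk.injEq] at h
      refine ⟨k + 1, by omega, le_rfl, ?_, ?_⟩
      · rw [h.1, (detector_values one ext Good w hrk).2, factor_succ _ _ _ hrk]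
      · rw [h.2, factor_of_le one ext w le_rfl]
    · obtain ⟨i, h1, h2, h3, h4⟩ := ih (by omega) hz
      refine ⟨i, h1, by omega, h3, ?_⟩
      rw [factor_succ _ _ _ h2, h4]
      exact hy.symm

theorem detector_complete {r i k : ℕ} (hri : r < i) (hik : i ≤ k)
    (hs : ∀ j, i ≤ j → j < k → ¬ Signals Good (detector one ext Good w r j)) :
    (factor one ext w r i, factor one ext w i k) ∈ (detector one ext Good w r k).2.2 := by
  induction k, hik using Nat.le_induction with
  | base =>
    obtain ⟨i, rfl⟩ : ∃ j, i = j + 1 := ⟨i - 1, by omega⟩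
    have hri' : r ≤ i := by omega
    rw [detector_succ _ _ _ _ hri', factor_of_le one ext w le_rfl (i := i + 1),
      factor_succ _ _ _ hri', ← (detector_values one ext Good w hri').2]
    exact Or.inl rfl
  | succ k hk ih =>
    rw [detector_succ _ _ _ _ (by omega), factor_succ _ _ _ hk]
    exact Or.inr ⟨hs k hk (by omega), _, ih fun j h1 h2 => hs j h1 (by omega), rfl⟩

/-- If the signals stopped, all later candidates would be kept, and the merging of one with a good
value would cause a further signal. -/
theorem frequently_signals_iff [Finite S] (r : ℕ) :
    (∃ᶠ k in atTop, r ≤ k ∧ Signals Good (detector one ext Good w r k)) ↔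
      ∃ e, Good (factor one ext w 0 r) e ∧ ∃ᶠ i in atTop, Merges one ext w r e i := by
  constructor
  · intro h
    have : ∃ᶠ i in atTop, ∃ e, Good (factor one ext w 0 r) e ∧ Merges one ext w r e i := by
      rw [frequently_atTop] at h ⊢
      intro N
      obtain ⟨k₀, hk₀, h1, h2⟩ := h N
      obtain ⟨k, hk, h3, e, he, h4⟩ := h (k₀ + 1)
      obtain ⟨i, g1, g2, g3, g4⟩ := detector_sound one ext Good w h1 h2 hk h4
      rw [(detector_values one ext Good w h3).1] at he
      rw [(detector_values one ext Good w h3).2] at g4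
      exact ⟨i, by omega, e, he, by omega, g3, k, g2, g4.symm⟩
    obtain ⟨e, he⟩ := exists_frequently this
    exact ⟨e, he.exists.choose_spec.1, he.mono fun i hi => hi.2⟩
  · rintro ⟨e, he, hfreq⟩
    by_contra hc
    obtain ⟨K, hK⟩ := eventually_atTop.1 (not_frequently.1 hc)
    obtain ⟨i, hi, h1, h2, k, hk, h3⟩ := frequently_atTop.1 hfreq (max K (r + 1))
    have := detector_complete one ext Good w (by omega : r < i) hk fun j hj _ hs =>
      hK j (by omega) ⟨by omega, hs⟩
    refine hK k (by omega) ⟨by omega, e, ?_, ?_⟩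
    · rwa [(detector_values one ext Good w (by omega)).1]
    · rwa [(detector_values one ext Good w (by omega)).2, h3, ← h2]

theorem isDetMuller_exists_linked {S : Type} [Finite B] [Finite S] (one : S) (ext : S → B → S)
    (Good : S → S → Prop) : IsDetMuller fun w : ℕ → B => ∃ s e, Good s e ∧ Linked one ext w s e := by
  let D := S × Set (Detector S × Set (Detector S))
  let step := detectorStep one ext Good
  let δ : D → B → D := fun d b =>
    (ext d.1 b, nextThreads step d.2 b (detectorStart one (ext d.1 b)))
  let d₀ : D := (one, {(detectorStart one one, ∅)})
  have hrun : ∀ w n, detRun d₀ δ w n = (factor one ext w 0 n,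
      threadsAt (fun r => detectorStart one (factor one ext w 0 r)) step w n) := by
    intro w n
    induction n with
    | zero => rw [threadsAt_zero]; rfl
    | succ n ih =>
      rw [detRun, ih, threadsAt_succ, factor_succ _ _ _ (Nat.zero_le n)]
  -- A rank is eventually stable when the limit set lies in the stable pairs, and signals infinitely
  -- often when the limit set meets the signalling ones. Stability depends on the letter read, hence
  -- the limit sets of pairs in `IsDetMuller`.
  refine ⟨D, inferInstance, d₀, δ, {Y | ∃ p, Y ⊆ {x | StableRank step p x.1.2 x.2} ∧
    ({x : D × B | ∃ y ∈ x.1.2, y.1 ∉ y.2 ∧ y.2.ncard = p ∧ Signals Good y.1} ∩ Y).Nonempty},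
    fun w => ?_⟩
  have h1 : (∃ s e, Good s e ∧ Linked one ext w s e) ↔
      ∃ r, ∃ᶠ k in atTop, r ≤ k ∧ Signals Good (detector one ext Good w r k) := by
    simp only [frequently_signals_iff]
    constructor
    · rintro ⟨_, e, h, r, rfl, hf⟩
      exact ⟨r, e, h, hf⟩
    · rintro ⟨r, e, h, hf⟩
      exact ⟨_, e, h, r, rfl, hf⟩
  refine h1.trans ?_
  refine (exists_thread_iff _ step w {x | Signals Good x}).trans (exists_congr fun p => ?_)
  rw [← eventually_mem_iff, ← frequently_mem_iff]
  simp only [hrun]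
  rfl

end Determinization

/-! ### Determinization of Muller word automata. -/

section Profiles

variable {B Z : Type*}

/-- The profile of the empty word. A profile is a set of triples of a state, the set of the
states visited in between, and a state. -/
def profileOne (Z : Type*) : Set (Z × Set Z × Z) := {x | x.2.1 = ∅ ∧ x.1 = x.2.2}

/-- The profile of a word prolonged by a letter. -/
def profileExt (T : Set (Z × B × Z)) (s : Set (Z × Set Z × Z)) (b : B) : Set (Z × Set Z × Z) :=
  {x | ∃ y X, (x.1, X, y) ∈ s ∧ (y, b, x.2.2) ∈ T ∧ x.2.1 = insert y X}

/-- `z` is a sequence of transitions in `T` between the positions `i` and `k`. -/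
def IsTrace (T : Set (Z × B × Z)) (w : ℕ → B) (z : ℕ → Z) (i k : ℕ) : Prop :=
  ∀ j, i ≤ j → j < k → (z j, w j, z (j + 1)) ∈ T

theorem mem_factor_profile {T : Set (Z × B × Z)} {w : ℕ → B} {i k : ℕ} (h : i ≤ k) {x y : Z}
    {X : Set Z} : (x, X, y) ∈ factor (profileOne Z) (profileExt T) w i k ↔
      ∃ z : ℕ → Z, z i = x ∧ z k = y ∧ IsTrace T w z i k ∧ X = z '' Ico i k := by
  classical
  induction k, h using Nat.le_induction generalizing y X with
  | base =>
    rw [factor_of_le _ _ _ le_rfl]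
    constructor
    · rintro ⟨h1, h2⟩
      exact ⟨fun _ => x, rfl, h2, fun j h3 h4 => by omega, by simpa using h1⟩
    · rintro ⟨z, rfl, rfl, -, rfl⟩
      exact ⟨by simp, rfl⟩
  | succ k hk ih =>
    rw [factor_succ _ _ _ hk]
    have hIco : Ico i (k + 1) = insert k (Ico i k) := by ext j; simp; omega
    constructor
    · rintro ⟨y', X', h1, h2, h3⟩
      obtain ⟨z, rfl, rfl, hz, rfl⟩ := ih.1 h1
      have hne : ∀ j ≤ k, Function.update z (k + 1) y j = z j := fun j hj =>
        Function.update_of_ne (by omega) _ _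
      refine ⟨Function.update z (k + 1) y, hne i hk, Function.update_self _ _ _,
        fun j hj1 hj2 => ?_, ?_⟩
      · rcases Nat.lt_succ_iff_lt_or_eq.1 hj2 with hj | rfl
        · rw [hne j (by omega), hne (j + 1) (by omega)]
          exact hz j hj1 hj
        · rw [hne j le_rfl, Function.update_self]
          exact h2
      · rw [hIco, image_insert_eq, hne k le_rfl]
        refine Eq.trans h3 (congrArg _ (image_congr fun j hj => (hne j hj.2.le).symm))
    · rintro ⟨z, rfl, rfl, hz, rfl⟩
      exact ⟨z k, _, ih.2 ⟨z, rfl, rfl, fun j h1 h2 => hz j h1 (by omega), rfl⟩,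
        hz k hk (Nat.lt_succ_self k), by rw [hIco, image_insert_eq]⟩

theorem exists_block {β : ℕ → ℕ} (hβ : StrictMono β) {j : ℕ} (hj : β 0 ≤ j) :
    ∃ n, β n ≤ j ∧ j < β (n + 1) := by
  have hex : ∃ n, j < β n := ⟨j + 1, (Nat.lt_succ_self j).trans_le (hβ.id_le _)⟩
  obtain ⟨n, hn⟩ : ∃ n, Nat.find hex = n + 1 := by
    refine Nat.exists_eq_succ_of_ne_zero fun h => ?_
    have := Nat.find_spec hex
    rw [h] at this
    omega
  refine ⟨n, not_lt.1 (Nat.find_min hex (m := n) (by omega)), ?_⟩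
  rw [← hn]
  exact Nat.find_spec hex

theorem block_unique {β : ℕ → ℕ} (hβ : StrictMono β) {j m n : ℕ} (h1 : β m ≤ j)
    (h2 : j < β (m + 1)) (h3 : β n ≤ j) (h4 : j < β (n + 1)) : m = n := by
  have := hβ.lt_iff_lt.1 (h1.trans_lt h4)
  have := hβ.lt_iff_lt.1 (h3.trans_lt h2)
  omega

theorem mem_infOften_iff_blocks {β : ℕ → ℕ} (hβ : StrictMono β) {z : ℕ → Z} {x : Z} :
    x ∈ infOften z ↔ ∃ᶠ n in atTop, x ∈ z '' Ico (β n) (β (n + 1)) := by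
  rw [mem_infOften, frequently_atTop, frequently_atTop]
  constructor
  · intro h N
    obtain ⟨j, hj, hx⟩ := h (β N)
    obtain ⟨n, h1, h2⟩ := exists_block hβ ((hβ.monotone (Nat.zero_le N)).trans hj)
    exact ⟨n, Nat.lt_succ_iff.1 (hβ.lt_iff_lt.1 (hj.trans_lt h2)), j, ⟨h1, h2⟩, hx⟩
  · intro h N
    obtain ⟨n, hn, j, hj, hx⟩ := h N
    exact ⟨j, (hn.trans (hβ.id_le n)).trans hj.1, hx⟩

/-- The infinite words on which the nondeterministic automaton with transitions `T` and initial
state `z₀` has a run whose set of states that appear infinitely often belongs to `𝓖`. -/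
def MullerAccepts (T : Set (Z × B × Z)) (z₀ : Z) (𝓖 : Set (Set Z)) (w : ℕ → B) : Prop :=
  ∃ z : ℕ → Z, z 0 = z₀ ∧ (∀ j, (z j, w j, z (j + 1)) ∈ T) ∧ infOften z ∈ 𝓖

/-- Corresponding blocks of the two factorizations have equal profiles, so an accepting run is
copied block by block with the same end states and the same visited states. The set of recurring
states does not change. -/
theorem MullerAccepts.of_linked {T : Set (Z × B × Z)} {z₀ : Z} {𝓖 : Set (Set Z)} {w w' : ℕ → B}
    {s e : Set (Z × Set Z × Z)} (h : MullerAccepts T z₀ 𝓖 w)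
    (hw : Linked (profileOne Z) (profileExt T) w s e)
    (hw' : Linked (profileOne Z) (profileExt T) w' s e) : MullerAccepts T z₀ 𝓖 w' := by
  classical
  obtain ⟨β, hβ, hβ0, hβe⟩ := hw.exists_factorization
  obtain ⟨γ, hγ, hγ0, hγe⟩ := hw'.exists_factorization
  obtain ⟨z, hz0, hz, hzF⟩ := h
  have hblock : ∀ n, ∃ f : ℕ → Z, f (γ n) = z (β n) ∧ f (γ (n + 1)) = z (β (n + 1)) ∧
      IsTrace T w' f (γ n) (γ (n + 1)) ∧
        z '' Ico (β n) (β (n + 1)) = f '' Ico (γ n) (γ (n + 1)) := by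
    intro n
    rw [← mem_factor_profile (hγ.monotone (Nat.le_succ n)), hγe, ← hβe n,
      mem_factor_profile (hβ.monotone (Nat.le_succ n))]
    exact ⟨z, rfl, rfl, fun j _ _ => hz j, rfl⟩
  obtain ⟨g, hg0, hg1, hg, -⟩ : ∃ g : ℕ → Z, g 0 = z₀ ∧ g (γ 0) = z (β 0) ∧
      IsTrace T w' g 0 (γ 0) ∧ z '' Ico 0 (β 0) = g '' Ico 0 (γ 0) := by
    rw [← mem_factor_profile (Nat.zero_le _), hγ0, ← hβ0, mem_factor_profile (Nat.zero_le _)]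
    exact ⟨z, hz0, rfl, fun j _ _ => hz j, rfl⟩
  choose f hf1 hf2 hf3 hf4 using hblock
  have hidx : ∀ j, ∃ n, γ 0 ≤ j → γ n ≤ j ∧ j < γ (n + 1) := fun j => by
    by_cases hj : γ 0 ≤ j
    · obtain ⟨n, hn⟩ := exists_block hγ hj
      exact ⟨n, fun _ => hn⟩
    · exact ⟨0, fun h => absurd h hj⟩
  choose idx hidx using hidx
  let z' : ℕ → Z := fun j => if j < γ 0 then g j else f (idx j) j
  have hz'g : ∀ j ≤ γ 0, z' j = g j := by
    intro j hj
    rcases hj.lt_or_eq with h | rfl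
    · exact if_pos h
    · obtain ⟨h1, h2⟩ := hidx (γ 0) le_rfl
      have : idx (γ 0) = 0 := block_unique hγ h1 h2 le_rfl (hγ (Nat.lt_succ_self 0))
      simp only [z', lt_irrefl, if_false]
      rw [this, hf1, hg1]
  have hz'f : ∀ n j, γ n ≤ j → j < γ (n + 1) → z' j = f n j := by
    intro n j h1 h2
    have h0 : γ 0 ≤ j := (hγ.monotone (Nat.zero_le n)).trans h1
    obtain ⟨h3, h4⟩ := hidx j h0
    rw [← block_unique hγ h3 h4 h1 h2]
    exact if_neg (not_lt.2 h0)
  have hz'f' : ∀ n, z' (γ (n + 1)) = f n (γ (n + 1)) := fun n => by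
    rw [hz'f (n + 1) _ le_rfl (hγ (Nat.lt_succ_self _)), hf1, hf2]
  refine ⟨z', by rw [hz'g 0 (Nat.zero_le _), hg0], fun j => ?_, ?_⟩
  · rcases lt_or_ge j (γ 0) with hj | hj
    · rw [hz'g j hj.le, hz'g (j + 1) hj]
      exact hg j (Nat.zero_le j) hj
    · obtain ⟨n, h1, h2⟩ := exists_block hγ hj
      have hsucc : z' (j + 1) = f n (j + 1) := by
        rcases (show j + 1 ≤ γ (n + 1) from h2).lt_or_eq with h3 | h3
        · exact hz'f n _ (by omega) h3
        · rw [h3, hz'f']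
      rw [hz'f n j h1 h2, hsucc]
      exact hf3 n j h1 h2
  · have : infOften z' = infOften z := by
      ext x
      rw [mem_infOften_iff_blocks hγ, mem_infOften_iff_blocks hβ]
      have : ∀ n, z' '' Ico (γ n) (γ (n + 1)) = z '' Ico (β n) (β (n + 1)) := fun n => by
        rw [hf4]
        exact image_congr fun j hj => hz'f n j hj.1 hj.2
      simp only [this]
    rwa [this]

theorem isDetMuller_mullerAccepts {B : Type*} {Z : Type} [Finite B] [Finite Z]
    (T : Set (Z × B × Z)) (z₀ : Z) (𝓖 : Set (Set Z)) :
    IsDetMuller (MullerAccepts T z₀ 𝓖) := by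
  -- A pair is good when some accepted word is linked to it. Every word is linked to some pair, and
  -- by `MullerAccepts.of_linked` any such pair decides acceptance.
  convert isDetMuller_exists_linked (profileOne Z) (profileExt T) (fun s e =>
    ∃ w, MullerAccepts T z₀ 𝓖 w ∧ Linked (profileOne Z) (profileExt T) w s e) using 1
  funext w
  refine propext ⟨fun h => ?_, ?_⟩
  · obtain ⟨s, e, hse⟩ := exists_linked (profileOne Z) (profileExt T) w
    exact ⟨s, e, ⟨w, h, hse⟩, hse⟩
  · rintro ⟨s, e, ⟨w', h, hse'⟩, hse⟩
    exact h.of_linked hse' hse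

theorem IsDetMuller.not {P : (ℕ → B) → Prop} (h : IsDetMuller P) :
    IsDetMuller fun w => ¬ P w := by
  obtain ⟨D, hD, d₀, δ, 𝓕, h⟩ := h
  exact ⟨D, hD, d₀, δ, 𝓕ᶜ, fun w => not_congr (h w)⟩

end Profiles

/-! ### Complementation of Muller tree automata. -/

section Complement

/-- The trees that can be labelled by letters of `Γ` in such a way that along every branch the
word of the labels and directions has a property recognized by a deterministic automaton. -/
theorem isMullerRecognizable_exists_labelling {A Γ : Type*} [Finite A] [Finite Γ]
    {P : (ℕ → A × Γ × Bool) → Prop} (hP : IsDetMuller P) :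
    IsMullerRecognizable {t : InfTree A | ∃ s : InfTree Γ, ∀ d : ℕ → Bool,
      P fun n => (path t d n, path s d n, d n)} := by
  classical
  obtain ⟨D, _, d₀, δ, 𝓕, hP⟩ := hP
  -- a state consists of the state of the word automaton and of the last transition, if any
  let M : TreeAutomaton A (D × Option (D × A × Γ × Bool)) :=
    { init := (d₀, none)
      trans := {x | ∃ γ : Γ,
        x.2.2.1 = (δ x.1.1 (x.2.1, γ, false), some (x.1.1, x.2.1, γ, false)) ∧
        x.2.2.2 = (δ x.1.1 (x.2.1, γ, true), some (x.1.1, x.2.1, γ, true))} }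
  have hacc : ∀ (ρ : InfTree (D × Option (D × A × Γ × Bool))) (d : ℕ → Bool)
      (w : ℕ → A × Γ × Bool), ρ [] = (d₀, none) →
      (∀ n, path ρ d (n + 1) = (δ (path ρ d n).1 (w n), some ((path ρ d n).1, w n))) →
      (infOften (path ρ d) ∈ {Y | some ⁻¹' (Prod.snd '' Y) ∈ 𝓕} ↔ P w) := by
    intro ρ d w h0 hstep
    have hrun : ∀ n, (path ρ d n).1 = detRun d₀ δ w n := by
      intro n
      induction n with
      | zero => simp [path, h0, detRun]
      | succ n ih => rw [hstep, detRun, ← ih]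
    rw [hP, ← infOften_shift (path ρ d) 1]
    have h1 : (fun n => path ρ d (n + 1)) =
        (fun x : D × A × Γ × Bool => (δ x.1 x.2, some x)) ∘ fun n => (detRun d₀ δ w n, w n) := by
      funext n
      rw [hstep, hrun]
      rfl
    rw [h1, infOften_comp, mem_ofPred_eq, image_image]
    simp only
    rw [preimage_image_eq _ (Option.some_injective _)]
  convert M.isMullerRecognizable {Y | some ⁻¹' (Prod.snd '' Y) ∈ 𝓕} using 1
  ext t
  constructor
  · rintro ⟨s, hs⟩
    -- The list is reversed so that the recursion consumes the last direction of the node.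
    let ρ : InfTree (D × Option (D × A × Γ × Bool)) := fun u =>
      u.reverse.rec (d₀, none) fun b v x =>
        (δ x.1 (t v.reverse, s v.reverse, b), some (x.1, t v.reverse, s v.reverse, b))
    have hρ : ∀ u b, ρ (u ++ [b]) = (δ (ρ u).1 (t u, s u, b), some ((ρ u).1, t u, s u, b)) := by
      intro u b
      simp only [ρ]
      rw [List.reverse_append]
      simp
    refine ⟨ρ, ⟨rfl, fun u => ⟨s u, hρ u false, hρ u true⟩⟩, fun d => ?_⟩
    refine (hacc ρ d (fun n => (path t d n, path s d n, d n)) rfl fun n => ?_).2 (hs d)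
    simp only [path]
    rw [branchNode_succ, hρ]
  · rintro ⟨ρ, ⟨h0, hρ⟩, hF⟩
    choose s hs using hρ
    refine ⟨s, fun d => (hacc ρ d _ h0 fun n => ?_).1 (hF d)⟩
    simp only [path]
    rw [branchNode_succ]
    cases d n
    · exact (hs _).1
    · exact (hs _).2

variable {A Q : Type*}

/-- The position of the acceptance game after a node, a state and a record. -/
abbrev GamePos (Q : Type*) : Type _ := Node × Q × (Q → Set Q)

/-- The next position of the acceptance game. -/
def GamePos.next (v : GamePos Q) (b : Bool) (q : Q) : GamePos Q :=
  (v.1 ++ [b], q, updateRecord v.2.2 v.2.1)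

/-- The choices of transitions in the acceptance game of `M` on `t`. -/
def gameMoves (M : TreeAutomaton A Q) (t : InfTree A) (v : GamePos Q) :
    Set (GamePos Q × GamePos Q) :=
  {m | ∃ q₀ q₁, (v.2.1, t v.1, q₀, q₁) ∈ M.trans ∧ m = (v.next false q₀, v.next true q₁)}

/-- The transitions along a branch that follow a strategy letter, which selects a direction for
each state, record and pair of states. -/
def branchTrans (M : TreeAutomaton A Q) :
    Set ((Q × (Q → Set Q)) × (A × (Q × (Q → Set Q) → Q × Q → Bool) × Bool) × (Q × (Q → Set Q))) :=
  {x | ∃ q₀ q₁, (x.1.1, x.2.1.1, q₀, q₁) ∈ M.trans ∧ x.2.1.2.1 x.1 (q₀, q₁) = x.2.1.2.2 ∧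
    x.2.2 = (pick (q₀, q₁) x.2.1.2.2, updateRecord x.1.2 x.1.1)}

theorem mem_mullerLanguage_of_runWins [Finite Q] (M : TreeAutomaton A Q) (𝓕 : Set (Set Q))
    (t : InfTree A) : RunWins (gameMoves M t) (fun v => recordColor 𝓕 v.2.1 v.2.2)
      ([], M.init, fun _ => ∅) → t ∈ M.mullerLanguage 𝓕 := by
  rintro ⟨f, hf0, hf, hfd⟩
  have hnode : ∀ u, (f u).1 = u := by
    intro u
    induction u using List.reverseRecOn with
    | nil => rw [hf0]
    | append_singleton u b ih =>
      obtain ⟨q₀, q₁, -, h⟩ := hf u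
      rw [Prod.mk.injEq] at h
      cases b
      · rw [h.1]; simp [GamePos.next, ih]
      · rw [h.2]; simp [GamePos.next, ih]
  have hrec : ∀ u b, (f (u ++ [b])).2.2 = updateRecord (f u).2.2 (f u).2.1 := by
    intro u b
    obtain ⟨q₀, q₁, -, h⟩ := hf u
    rw [Prod.mk.injEq] at h
    cases b
    · rw [h.1]; rfl
    · rw [h.2]; rfl
  refine ⟨fun u => (f u).2.1, ⟨by beta_reduce; rw [hf0], fun u => ?_⟩, fun d => ?_⟩
  · obtain ⟨q₀, q₁, h1, h⟩ := hf u
    rw [Prod.mk.injEq] at h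
    rw [hnode] at h1
    beta_reduce
    rw [h.1, h.2]
    exact h1
  · have : ∀ n, (path f d n).2.2 = recordAt (path (fun u => (f u).2.1) d) n := by
      intro n
      induction n with
      | zero => simp [path, hf0, recordAt]
      | succ n ih =>
        rw [recordAt, ← ih]
        simp only [path]
        rw [branchNode_succ, hrec]
    have hg := hfd d
    simp only [this] at hg
    exact (parityGood_recordColor 𝓕 _).1 hg

/-- A positional strategy of the opponent assigns to each node a function of state, record and
transition, that is, a letter of a finite alphabet. It wins exactly if no run along any branch is
both consistent with it and accepting. -/
theorem compl_mullerLanguage {Q : Type} [Finite Q] (M : TreeAutomaton A Q) (𝓕 : Set (Set Q)) :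
    (M.mullerLanguage 𝓕)ᶜ = {t | ∃ s : InfTree (Q × (Q → Set Q) → Q × Q → Bool),
      ∀ d : ℕ → Bool, ¬ MullerAccepts (branchTrans M) (M.init, fun _ => ∅)
        {Y | Prod.fst '' Y ∈ 𝓕} fun n => (path t d n, path s d n, d n)} := by
  classical
  ext t
  constructor
  · intro ht
    obtain ⟨τ, hτ⟩ := positional_determinacy _ (gameMoves M t)
      (fun v => recordColor 𝓕 v.2.1 v.2.2) fun v => recordColor_le 𝓕 v.2.1 v.2.2
    have hA := (hτ ([], M.init, fun _ => ∅)).resolve_left fun h =>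
      ht (mem_mullerLanguage_of_runWins M 𝓕 t h)
    refine ⟨fun u z q => τ (u, z) (GamePos.next (u, z) false q.1, GamePos.next (u, z) true q.2),
      fun d => ?_⟩
    rintro ⟨z, hz0, hz, hzF⟩
    have hz2 : ∀ n, (z n).2 = recordAt (fun n => (z n).1) n := by
      intro n
      induction n with
      | zero => rw [hz0]; rfl
      | succ n ih =>
        obtain ⟨q₀, q₁, -, -, h⟩ := hz n
        rw [recordAt, ← ih]
        exact congrArg Prod.snd h
    refine hA (fun n => (branchNode d n, z n)) (by simp [hz0]) (fun n => ?_) ?_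
    · obtain ⟨q₀, q₁, h1, h2, h3⟩ := hz n
      refine ⟨_, ⟨q₀, q₁, h1, rfl⟩, ?_⟩
      have h2 : τ (branchNode d n, z n) (GamePos.next (branchNode d n, z n) false q₀,
        GamePos.next (branchNode d n, z n) true q₁) = d n := h2
      have h3 : z (n + 1) = (pick (q₀, q₁) (d n), updateRecord (z n).2 (z n).1) := h3
      simp only
      rw [h2, h3, branchNode_succ]
      cases d n <;> rfl
    · simp only [hz2]
      rw [parityGood_recordColor]
      have := infOften_comp Prod.fst z
      rw [show (fun n => (z n).1) = Prod.fst ∘ z from rfl, this]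
      exact hzF
  · rintro ⟨s, hs⟩ ⟨ρ, ⟨hρ0, hρ⟩, hF⟩
    let recs : Node → Q → Set Q := fun u =>
      u.reverse.rec (fun _ => ∅) fun _ v R => updateRecord R (ρ v.reverse)
    have hrec : ∀ u b, recs (u ++ [b]) = updateRecord (recs u) (ρ u) := by
      intro u b
      simp only [recs]
      rw [List.reverse_append]
      simp
    -- Playing the strategy against the accepting run `ρ` singles out a branch, along which `ρ` with
    -- its records is accepted by the branch automaton.
    obtain ⟨d, hd⟩ := exists_branch fun u => s u (ρ u, recs u) (ρ (u ++ [false]), ρ (u ++ [true]))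
    refine hs d ⟨fun n => (path ρ d n, recs (branchNode d n)), ?_, fun n => ?_, ?_⟩
    · simp [path, hρ0, recs]
    · refine ⟨ρ (branchNode d n ++ [false]), ρ (branchNode d n ++ [true]), hρ _, (hd n).symm, ?_⟩
      simp only [path]
      rw [branchNode_succ, hrec]
      cases d n <;> rfl
    · rw [mem_ofPred_eq, ← infOften_comp]
      exact hF d

theorem IsMullerRecognizable.compl {A : Type*} [Finite A] {L : Set (InfTree A)}
    (h : IsMullerRecognizable L) : IsMullerRecognizable Lᶜ := by
  obtain ⟨Q, _, M, 𝓕, rfl⟩ := h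
  rw [compl_mullerLanguage]
  exact isMullerRecognizable_exists_labelling (isDetMuller_mullerAccepts _ _ _).not

end Complement

/-! ### Consequences for the two topologies. -/

section Topologies

theorem isZeroDimensional_mullerTopology (A : Type*) [Finite A] :
    @IsZeroDimensional (InfTree A) (mullerTopology A) := by
  let := mullerTopology A
  refine ⟨_, TopologicalSpace.isTopologicalBasis_of_subbasis rfl, ?_⟩
  rintro _ ⟨f, ⟨hf, hfs⟩, rfl⟩
  have hopen : ∀ L : Set (InfTree A), IsMullerRecognizable L → IsOpen L := fun L hL =>
    TopologicalSpace.isOpen_generateFrom_of_mem hL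
  exact ⟨isClosed_sInter fun L hL => isOpen_compl_iff.1 (hopen _ (hfs hL).compl),
    hf.isOpen_sInter fun L hL => hopen _ (hfs hL)⟩

theorem IsZeroDimensional.regularSpace {X : Type*} [TopologicalSpace X] (h : IsZeroDimensional X) :
    RegularSpace X := by
  obtain ⟨B, hB, hclopen⟩ := h
  refine RegularSpace.of_exists_mem_nhds_isClosed_subset fun x s hs => ?_
  obtain ⟨t, ht, hxt, hts⟩ := hB.mem_nhds_iff.1 hs
  exact ⟨t, (hclopen t ht).2.mem_nhds hxt, (hclopen t ht).1, hts⟩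

theorem t2Space_of_le_cantor {A : Type*} (τ : TopologicalSpace (InfTree A))
    (h : τ ≤ cantorTopology A) : @T2Space _ τ := by
  let : TopologicalSpace A := ⊥
  have : DiscreteTopology A := ⟨rfl⟩
  have hid : @Continuous _ _ τ (cantorTopology A) id := continuous_id_of_le h
  exact @T2Space.of_injective_continuous _ _ τ (cantorTopology A) _ id Function.injective_id hid

theorem metrizableSpace_of_regularSpace {A : Type*} (τ : TopologicalSpace (InfTree A))
    (h : τ ≤ cantorTopology A) (h2 : @SecondCountableTopology _ τ) (h3 : @RegularSpace _ τ) :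
    @TopologicalSpace.MetrizableSpace _ τ := by
  have := t2Space_of_le_cantor τ h
  exact TopologicalSpace.metrizableSpace_of_t3_secondCountable _

theorem not_isStrongChoquet_of_regularSpace {A : Type*} [Nontrivial A]
    (τ : TopologicalSpace (InfTree A)) (h : τ ≤ buchiTopology A)
    (h2 : @SecondCountableTopology _ τ) (h3 : @RegularSpace _ τ) :
    ¬ @IsStrongChoquet _ τ := by
  intro hc
  obtain ⟨a, b, hab⟩ := exists_pair_ne A
  have hcantor := h.trans (buchiTopology_le_cantor A)
  have := metrizableSpace_of_regularSpace τ hcantor h2 h3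
  exact not_exists_continuous_surjective hab τ hcantor
    (h _ (TopologicalSpace.isOpen_generateFrom_of_mem (isBuchiRecognizable_exists_branch a)))
    hc.exists_nat_nat_continuous_surjective

theorem not_polishSpace {A : Type*} [Nontrivial A]
    (τ : TopologicalSpace (InfTree A)) (h : τ ≤ buchiTopology A) : ¬ @PolishSpace _ τ := by
  intro hP
  obtain ⟨a, b, hab⟩ := exists_pair_ne A
  have : Nonempty (InfTree A) := ⟨fun _ => a⟩
  exact not_exists_continuous_surjective hab τ (h.trans (buchiTopology_le_cantor A))
    (h _ (TopologicalSpace.isOpen_generateFrom_of_mem (isBuchiRecognizable_exists_branch a)))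
    (PolishSpace.exists_nat_nat_continuous_surjective _)

/-- Regularity fails only indirectly: it would imply metrizability, which is incompatible with the
strong Choquet property here. -/
theorem not_regularSpace_buchiTopology (A : Type*) [Finite A] [Nontrivial A] :
    ¬ @RegularSpace (InfTree A) (buchiTopology A) := fun h =>
  not_isStrongChoquet_of_regularSpace _ le_rfl (secondCountable_buchiTopology A) h
    (isStrongChoquet_buchi A)

end Topologies

end TreeTopology

theorem mainTheorem4 (A : Type*) [Finite A] [Nontrivial A] :
    (@TreeTopology.IsStrongChoquet (TreeTopology.InfTree A) (TreeTopology.buchiTopology A) ∧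
      ¬ @RegularSpace (TreeTopology.InfTree A) (TreeTopology.buchiTopology A) ∧
      ¬ @TreeTopology.IsZeroDimensional (TreeTopology.InfTree A)
          (TreeTopology.buchiTopology A) ∧
      ¬ @TopologicalSpace.MetrizableSpace (TreeTopology.InfTree A)
          (TreeTopology.buchiTopology A)) ∧
    (@TreeTopology.IsZeroDimensional (TreeTopology.InfTree A) (TreeTopology.mullerTopology A) ∧
      @RegularSpace (TreeTopology.InfTree A) (TreeTopology.mullerTopology A) ∧
      @TopologicalSpace.MetrizableSpace (TreeTopology.InfTree A)
          (TreeTopology.mullerTopology A) ∧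
      ¬ @TreeTopology.IsStrongChoquet (TreeTopology.InfTree A)
          (TreeTopology.mullerTopology A)) ∧
    (¬ @PolishSpace (TreeTopology.InfTree A) (TreeTopology.buchiTopology A) ∧
      ¬ @PolishSpace (TreeTopology.InfTree A) (TreeTopology.mullerTopology A)) := by
  have hnr := TreeTopology.not_regularSpace_buchiTopology A
  have hzd := TreeTopology.isZeroDimensional_mullerTopology A
  have hr := @TreeTopology.IsZeroDimensional.regularSpace _ (TreeTopology.mullerTopology A) hzd
  have hle := TreeTopology.mullerTopology_le_buchi A
  have h2 := TreeTopology.secondCountable_mullerTopology A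
  refine ⟨⟨TreeTopology.isStrongChoquet_buchi A, hnr, fun h => ?_, fun h => ?_⟩,
    ⟨hzd, hr, ?_, ?_⟩, ?_, ?_⟩
  · exact hnr (@TreeTopology.IsZeroDimensional.regularSpace _ (TreeTopology.buchiTopology A) h)
  · let := TreeTopology.buchiTopology A
    exact hnr inferInstance
  · exact TreeTopology.metrizableSpace_of_regularSpace _
      (hle.trans (TreeTopology.buchiTopology_le_cantor A)) h2 hr
  · exact TreeTopology.not_isStrongChoquet_of_regularSpace _ hle h2 hr
  · exact TreeTopology.not_polishSpace _ le_rfl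
  · exact TreeTopology.not_polishSpace _ hle
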